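/- Let $\Bbbk$ be an algebraically closed field of characteristic $0$, and let $X$ be a finite set with $|X|=m\ge 2$. Let $r:X\times X\to X\times X$, $r(i,j)=(\sigma_i(j),\tau_j(i))$, be a non-degenerate involutive set-theoretical solution of the Yang–Baxter equation; that is, $r$ is bijective, $(r\times\mathrm{id})(\mathrm{id}\times r)(r\times\mathrm{id})=(\mathrm{id}\times r)(r\times\mathrm{id})(\mathrm{id}\times r)$, $r^2=\mathrm{id}$, and all maps $\sigma_i,\tau_i:X\to X$ are bijective. Let $D:X\to X$, $D(i)=\tau_i^{-1}(i)$. Let $R_{i,j}\in\Bbbk^\times$ $(i,j\in X)$ satisfy $$R_{i,j}R_{\tau_j(i),k}R_{\sigma_i(j),\sigma_{\tau_j(i)}(k)}=R_{j,k}R_{i,\sigma_j(k)}R_{\tau_{\sigma_j(k)}(i),\tau_k(j)}\qquad\text{for all } i,j,k\in X,$$ and let $W_{X,r}=\bigoplus_{i\in X}\Bbbk w_i$ be the braided vector space with braiding $c(w_i\otimes w_j)=R_{i,j}\,w_{\sigma_i(j)}\otimes w_{\tau_j(i)}$. Let $\mathfrak B(W_{X,r})=T(W_{X,r})/\bigoplus_{n}\ker\mathfrak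 S_n$ be its Nichols algebra, where $\mathfrak S_n\in\mathrm{End}_\Bbbk(W_{X,r}^{\otimes n})$ is the quantum symmetrizer of $c$: writing $c_l$ for $c$ acting on the $l$-th and $(l+1)$-st tensor factors, $\mathfrak S_0=\mathfrak S_1=\mathrm{id}$ and $\mathfrak S_{n+1}=(\mathrm{id}+c_n+c_{n-1}c_n+\cdots+c_1\cdots c_{n-1}c_n)(\mathfrak S_n\otimes\mathrm{id})$ for $n\ge1$. Assume that there is $q\in\Bbbk$ with $R_{D(i),i}=q$ for all $i\in X$, that $q$ is not a primitive $n$-th root of unity for any $n\ge 2$ (the value $q=1$ is allowed), and that $R_{i,j}R_{\sigma_i(j),\tau_j(i)}=1$ for all $i,j\in X$ with $i\ne D(j)$. Then the Gelfand–Kirillov dimension of $\mathfrak B(W_{X,r})$ is $m$. -/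

import Mathlib

open scoped TensorProduct

/-- A set-theoretical solution `(X, r)` of the Yang-Baxter equation: a bijection
`r : X × X → X × X` with
`(r × id)(id × r)(r × id) = (id × r)(r × id)(id × r)` on `X × X × X`. -/
structure YBESolution (X : Type*) where
  r : X × X → X × X
  bijective : Function.Bijective r
  braid :
    let r₁ : X × X × X → X × X × X := fun p => ((r (p.1, p.2.1)).1, (r (p.1, p.2.1)).2, p.2.2)
    let r₂ : X × X × X → X × X × X := fun p => (p.1, r p.2)
    r₁ ∘ r₂ ∘ r₁ = r₂ ∘ r₁ ∘ r₂

namespace YBESolution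

variable {X : Type*} (S : YBESolution X)

/-- `σ_i(j)`, where `r (i, j) = (σ_i(j), τ_j(i))`. -/
def σ (i j : X) : X := (S.r (i, j)).1

/-- `τ_j(i)`, where `r (i, j) = (σ_i(j), τ_j(i))`. The subscript comes first. -/
def τ (j i : X) : X := (S.r (i, j)).2

/-- All the maps `σ_i` and `τ_i` are bijective. -/
structure Nondegenerate : Prop where
  σ_bijective : ∀ i, Function.Bijective (S.σ i)
  τ_bijective : ∀ i, Function.Bijective (S.τ i)

/-- `r² = id`. -/
def Involutive : Prop := Function.Involutive S.r

/-- The diagonal `D(i) = τ_i⁻¹(i)` of a non-degenerate solution. -/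
noncomputable def diag (hS : S.Nondegenerate) (i : X) : X :=
  (Equiv.ofBijective (S.τ i) (hS.τ_bijective i)).symm i

end YBESolution

/-- A braiding on a vector space `V`: a linear automorphism `c` of `V ⊗ V` with
`(c ⊗ id)(id ⊗ c)(c ⊗ id) = (id ⊗ c)(c ⊗ id)(id ⊗ c)` on `V ⊗ V ⊗ V`. -/
structure Braiding (k V : Type*) [Field k] [AddCommGroup V] [Module k V] where
  c : (V ⊗[k] V) ≃ₗ[k] (V ⊗[k] V)
  braid :
    let c₁ : ((V ⊗[k] V) ⊗[k] V) →ₗ[k] ((V ⊗[k] V) ⊗[k] V) := c.toLinearMap.rTensor V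
    let c₂ : ((V ⊗[k] V) ⊗[k] V) →ₗ[k] ((V ⊗[k] V) ⊗[k] V) :=
      (TensorProduct.assoc k V V V).symm.toLinearMap ∘ₗ c.toLinearMap.lTensor V ∘ₗ
        (TensorProduct.assoc k V V V).toLinearMap
    c₁ ∘ₗ c₂ ∘ₗ c₁ = c₂ ∘ₗ c₁ ∘ₗ c₂

/-! ### The Nichols algebra of a braided vector space -/

namespace Nichols



variable {k V : Type*} [Field k] [AddCommGroup V] [Module k V]

/-- For `i ≠ j`, the linear map `V ⊗ V → V^{⊗n}` sending `a ⊗ b` to `v_1 ⊗ ⋯ ⊗ v_n` with the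
`i`-th factor replaced by `a` and the `j`-th factor replaced by `b`. -/
noncomputable def place {n : ℕ} (i j : Fin n) (hij : i ≠ j) (v : Fin n → V) :
    (V ⊗[k] V) →ₗ[k] (⨂[k]^n V) :=
  TensorProduct.lift <| LinearMap.mk₂ k
    (fun a b => PiTensorProduct.tprod k (Function.update (Function.update v i a) j b))
    (fun a a' b => by
      simp only [Function.update_comm hij, MultilinearMap.map_update_add])
    (fun t a b => by
      simp only [Function.update_comm hij, MultilinearMap.map_update_smul])
    (fun a b b' => by simp only [MultilinearMap.map_update_add])
    (fun t a b => by simp only [MultilinearMap.map_update_smul])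

theorem place_tmul {n : ℕ} (i j : Fin n) (hij : i ≠ j) (v : Fin n → V) (a b : V) :
    place (k := k) i j hij v (a ⊗ₜ b) =
      PiTensorProduct.tprod k (Function.update (Function.update v i a) j b) := rfl

theorem place_update_left {n : ℕ} (i j : Fin n) (hij : i ≠ j) (v : Fin n → V) (x : V) :
    place (k := k) i j hij (Function.update v i x) = place i j hij v := by
  ext a b
  simp [place_tmul]

theorem place_update_right {n : ℕ} (i j : Fin n) (hij : i ≠ j) (v : Fin n → V) (x : V) :
    place (k := k) i j hij (Function.update v j x) = place i j hij v := by
  ext a b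
  simp [place_tmul, Function.update_comm hij]

/-- The linear endomorphism of `V^{⊗n}` applying `c` to the `i`-th and `j`-th factors. -/
noncomputable def applyAt (c : (V ⊗[k] V) →ₗ[k] (V ⊗[k] V)) {n : ℕ} (i j : Fin n) (hij : i ≠ j) :
    Module.End k (⨂[k]^n V) :=
  PiTensorProduct.lift
    { toFun := fun v => place (k := k) i j hij v (c (v i ⊗ₜ v j))
      map_update_add' := by
        intro inst v l x y
        obtain rfl : inst = instDecidableEqFin n := Subsingleton.elim _ _
        by_cases hi : l = i
        · subst hi
          simp only [place_update_left, Function.update_self, Function.update_of_ne hij.symm,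
            TensorProduct.add_tmul, map_add]
        · by_cases hj : l = j
          · subst hj
            simp only [place_update_right, Function.update_self, Function.update_of_ne hij,
              TensorProduct.tmul_add, map_add]
          · simp only [Function.update_of_ne (Ne.symm hi), Function.update_of_ne (Ne.symm hj)]
            rw [← LinearMap.add_apply]
            congr 1
            ext a b
            simp only [TensorProduct.AlgebraTensorModule.curry_apply, TensorProduct.curry_apply,
              LinearMap.coe_restrictScalars, LinearMap.add_apply, place_tmul]
            simp only [Function.update_comm hi, Function.update_comm hj,
              MultilinearMap.map_update_add]
      map_update_smul' := by
        intro inst v l t x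
        obtain rfl : inst = instDecidableEqFin n := Subsingleton.elim _ _
        by_cases hi : l = i
        · subst hi
          simp only [place_update_left, Function.update_self, Function.update_of_ne hij.symm,
            ← TensorProduct.smul_tmul', map_smul]
        · by_cases hj : l = j
          · subst hj
            simp only [place_update_right, Function.update_self, Function.update_of_ne hij,
              TensorProduct.tmul_smul, map_smul]
          · simp only [Function.update_of_ne (Ne.symm hi), Function.update_of_ne (Ne.symm hj)]
            rw [← LinearMap.smul_apply]
            congr 1
            ext a b
            simp only [TensorProduct.AlgebraTensorModule.curry_apply, TensorProduct.curry_apply,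
              LinearMap.coe_restrictScalars, LinearMap.smul_apply, place_tmul]
            simp only [Function.update_comm hi, Function.update_comm hj,
              MultilinearMap.map_update_smul] }

/-- The operator `c_{i+1} = id^{⊗i} ⊗ c ⊗ id^{⊗(n-i-2)}` on `V^{⊗n}`, acting on the factors with
(zero-based) positions `i` and `i + 1`. For `i + 1 ≥ n` it is set to be the identity; these values
are not used in the quantum symmetrizer. -/
noncomputable def braidAt (c : (V ⊗[k] V) →ₗ[k] (V ⊗[k] V)) (n i : ℕ) :
    Module.End k (⨂[k]^n V) :=
  if h : i + 1 < n then
    applyAt c ⟨i, Nat.lt_of_succ_lt h⟩ ⟨i + 1, h⟩ (by simp [Fin.ext_iff])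
  else 1

/-- The operator `𝔖_{l,1} ⊗ id^{⊗(n-l-1)}` on `V^{⊗n}`, where
`𝔖_{l,1} = id + c_l + c_{l-1} c_l + ⋯ + c_1 ⋯ c_l`, through the recursion
`𝔖_{l+1,1} = id + 𝔖_{l,1} c_{l+1}`. -/
noncomputable def shuffleSum (c : (V ⊗[k] V) →ₗ[k] (V ⊗[k] V)) (n : ℕ) :
    ℕ → Module.End k (⨂[k]^n V)
  | 0 => 1
  | l + 1 => 1 + shuffleSum c n l * braidAt c n l

/-- The operator `𝔖_l ⊗ id^{⊗(n-l)}` on `V^{⊗n}`, through the recursion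
`𝔖_{l+1} = 𝔖_{l,1} (𝔖_l ⊗ id)`. -/
noncomputable def partialSymmetrizer (c : (V ⊗[k] V) →ₗ[k] (V ⊗[k] V)) (n : ℕ) :
    ℕ → Module.End k (⨂[k]^n V)
  | 0 => 1
  | l + 1 => shuffleSum c n l * partialSymmetrizer c n l

/-- The quantum symmetrizer `𝔖_n` on `V^{⊗n}`. -/
noncomputable def symmetrizer (c : (V ⊗[k] V) →ₗ[k] (V ⊗[k] V)) (n : ℕ) :
    Module.End k (⨂[k]^n V) :=
  partialSymmetrizer c n n

/-- The relations of the Nichols algebra: every element of `ker 𝔖_n ⊆ V^{⊗n} ⊆ T(V)` is zero. -/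
inductive Rel (B : Braiding k V) : TensorAlgebra k V → TensorAlgebra k V → Prop
  | of (n : ℕ) (x : ⨂[k]^n V) (hx : symmetrizer B.c.toLinearMap n x = 0) :
      Rel B (TensorPower.toTensorAlgebra x) 0

end Nichols

/-- The Nichols algebra `𝔅(V, c) = T(V) / ⨁ₙ ker 𝔖_n` of a braided vector space, as the quotient
of the tensor algebra by the two-sided ideal generated by the kernels of the quantum symmetrizers
(by the braid equation their sum is already a two-sided ideal). -/
abbrev NicholsAlgebra {k V : Type*} [Field k] [AddCommGroup V] [Module k V] (B : Braiding k V) :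
    Type _ :=
  RingQuot (Nichols.Rel B)

/-- The Gelfand-Kirillov dimension of a `k`-algebra `A`: the supremum, over the finite-dimensional
subspaces `U` of `A`, of `limsup log_n dim (k + U + U² + ⋯ + Uⁿ)`. -/
noncomputable def GKdim (k A : Type*) [Field k] [Ring A] [Algebra k A] : EReal :=
  ⨆ (U : Submodule k A) (_ : FiniteDimensional k U),
    Filter.limsup
      (fun n : ℕ =>
        ((Real.logb n (Module.finrank k (⨆ i ∈ Finset.range (n + 1), U ^ i : Submodule k A)) : ℝ) :
          EReal))
      Filter.atTop

/-! ### The braided vector spaces `W_{X,r}` -/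

/-- Coefficients `R_{i,j} ∈ k^×` for which `c(w_i ⊗ w_j) = R_{i,j} w_{σ_i(j)} ⊗ w_{τ_j(i)}`
satisfies the braid equation. -/
structure BraidingCoeff {X : Type*} (S : YBESolution X) (k : Type*) [Field k] where
  R : X → X → k
  ne_zero : ∀ i j, R i j ≠ 0
  compat : ∀ i j l,
    R i j * R (S.τ j i) l * R (S.σ i j) (S.σ (S.τ j i) l) =
      R j l * R i (S.σ j l) * R (S.τ (S.σ j l) i) (S.τ l j)

namespace BraidingCoeff

variable {X : Type*} {S : YBESolution X} {k : Type*} [Field k] (C : BraidingCoeff S k)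

/-- The basis `w_i ⊗ w_j` of `W ⊗ W`, where `W = ⨁_{i ∈ X} k w_i` is `X →₀ k`. -/
noncomputable def basis₂ (X k : Type*) [Field k] :
    Module.Basis (X × X) k ((X →₀ k) ⊗[k] (X →₀ k)) :=
  (Finsupp.basisSingleOne (R := k) (ι := X)).tensorProduct Finsupp.basisSingleOne

theorem basis₂_apply (p : X × X) :
    basis₂ X k p = Finsupp.single p.1 1 ⊗ₜ[k] Finsupp.single p.2 1 := by
  simp [basis₂, Module.Basis.tensorProduct_apply']

/-- The linear map `w_i ⊗ w_j ↦ R_{i,j} w_{σ_i(j)} ⊗ w_{τ_j(i)}`. -/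
noncomputable def cMap : ((X →₀ k) ⊗[k] (X →₀ k)) →ₗ[k] ((X →₀ k) ⊗[k] (X →₀ k)) :=
  (basis₂ X k).constr k fun p =>
    C.R p.1 p.2 • (Finsupp.single (S.σ p.1 p.2) 1 ⊗ₜ[k] Finsupp.single (S.τ p.2 p.1) 1)

theorem cMap_single (i j : X) :
    C.cMap (Finsupp.single i 1 ⊗ₜ[k] Finsupp.single j 1) =
      C.R i j • (Finsupp.single (S.σ i j) 1 ⊗ₜ[k] Finsupp.single (S.τ j i) 1) := by
  have := (basis₂ X k).constr_basis k (fun p : X × X =>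
    C.R p.1 p.2 • (Finsupp.single (S.σ p.1 p.2) (1 : k) ⊗ₜ[k] Finsupp.single (S.τ p.2 p.1) (1 : k)))
    (i, j)
  rwa [basis₂_apply] at this

theorem cMap_bijective : Function.Bijective C.cMap := by
  let e : X × X ≃ X × X := Equiv.ofBijective S.r S.bijective
  have hc : ∀ p, C.cMap (basis₂ X k p) = C.R p.1 p.2 • basis₂ X k (e p) := fun p => by
    rw [basis₂_apply, basis₂_apply, cMap_single]; rfl
  let d : ((X →₀ k) ⊗[k] (X →₀ k)) →ₗ[k] ((X →₀ k) ⊗[k] (X →₀ k)) :=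
    (basis₂ X k).constr k fun p =>
      (C.R (e.symm p).1 (e.symm p).2)⁻¹ • basis₂ X k (e.symm p)
  have hd : ∀ p, d (basis₂ X k p) = (C.R (e.symm p).1 (e.symm p).2)⁻¹ • basis₂ X k (e.symm p) :=
    fun p => (basis₂ X k).constr_basis k _ p
  have h1 : d ∘ₗ C.cMap = LinearMap.id := (basis₂ X k).ext fun p => by
    simp only [LinearMap.comp_apply, hc, map_smul, hd, Equiv.symm_apply_apply, smul_smul,
      LinearMap.id_apply, mul_inv_cancel₀ (C.ne_zero _ _), one_smul]
  have h2 : C.cMap ∘ₗ d = LinearMap.id := (basis₂ X k).ext fun p => by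
    simp only [LinearMap.comp_apply, hc, map_smul, hd, Equiv.apply_symm_apply, smul_smul,
      LinearMap.id_apply, inv_mul_cancel₀ (C.ne_zero _ _), one_smul]
  exact Function.bijective_iff_has_inverse.2
    ⟨d, fun x => LinearMap.congr_fun h1 x, fun x => LinearMap.congr_fun h2 x⟩

/-- The braided vector space `W_{X,r}`: the space `X →₀ k` with basis `w_i = single i 1` and the
braiding `c(w_i ⊗ w_j) = R_{i,j} w_{σ_i(j)} ⊗ w_{τ_j(i)}`. -/
noncomputable def braiding : Braiding k (X →₀ k) where
  c := LinearEquiv.ofBijective C.cMap C.cMap_bijective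
  braid := by
    intro c₁ c₂
    have hσ : ∀ i j l,
        S.σ (S.σ i j) (S.σ (S.τ j i) l) = S.σ i (S.σ j l) ∧
        S.τ (S.σ (S.τ j i) l) (S.σ i j) = S.σ (S.τ (S.σ j l) i) (S.τ l j) ∧
        S.τ l (S.τ j i) = S.τ (S.τ l j) (S.τ (S.σ j l) i) := fun i j l => by
      have h := congrFun S.braid (i, j, l)
      simp only [Function.comp_apply, Prod.ext_iff] at h
      exact h
    have hc₁ : ∀ i j l : X,
        c₁ ((Finsupp.single i 1 ⊗ₜ Finsupp.single j 1) ⊗ₜ Finsupp.single l 1) =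
          C.R i j • ((Finsupp.single (S.σ i j) 1 ⊗ₜ Finsupp.single (S.τ j i) 1) ⊗ₜ
            Finsupp.single l 1) := fun i j l => by
      simp only [c₁, LinearMap.rTensor_tmul, LinearEquiv.coe_coe, LinearEquiv.ofBijective_apply,
        cMap_single, TensorProduct.smul_tmul']
    have hc₂ : ∀ i j l : X,
        c₂ ((Finsupp.single i 1 ⊗ₜ Finsupp.single j 1) ⊗ₜ Finsupp.single l 1) =
          C.R j l • ((Finsupp.single i 1 ⊗ₜ Finsupp.single (S.σ j l) 1) ⊗ₜ
            Finsupp.single (S.τ l j) 1) := fun i j l => by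
      simp only [c₂, LinearMap.comp_apply, LinearMap.lTensor_tmul, LinearEquiv.coe_coe,
        TensorProduct.assoc_tmul, LinearEquiv.ofBijective_apply, cMap_single,
        TensorProduct.tmul_smul, map_smul, TensorProduct.assoc_symm_tmul]
    ext i j l : 8
    simp only [LinearMap.comp_apply, TensorProduct.AlgebraTensorModule.curry_apply,
      TensorProduct.curry_apply, LinearMap.coe_restrictScalars, Finsupp.lsingle_apply,
      hc₁, hc₂, map_smul, smul_smul]
    obtain ⟨h1, h2, h3⟩ := hσ i j l
    have h := C.compat i j l
    rw [h1, h2, h3, h]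

end BraidingCoeff

/-! After a change of coordinates on words, the braiding is the flip of two letters, multiplied by
`q` when they are equal. The Nichols algebra therefore grows like a polynomial ring in m variables.

Coordinates: the guitar map turns r on adjacent letters into the flip. It exists because
σ_{x_1}⋯σ_{x_n} depends only on the multiset of image letters (`frame`), so a word is a path in the
lattice of multisets. A pair (i, j) with i = D(j) becomes two equal letters; any other pair spans a
square of the lattice, weighted by R_{i,j}. On these squares the condition `hR` says that the
weights form an antisymmetric multiplicative 2-form, and the compatibility of R says that it is
closed on cubes. Closed forms on this lattice are exact (`exists_potential`), and rescaling each
word by the potential along its path removes R from all pairs of unequal letters (`exists_gauge`).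

Kernels: in these coordinates the transposed symmetrizer sends the coefficient functional of a word
to a nonzero product of quantum factorials times the sum over all rearrangements
(`coeffFunctional_comp_partialSymmetrizer`). Coefficients of a kernel element thus sum to zero over
each orbit, so the kernels vanish in every algebra satisfying the quadratic relations
(`QuadraticRelations.map_eq_zero`).

Growth: the kernel in degree two gives the quadratic relations in the Nichols algebra, so one
element per multiset spans it. Conversely, operators on the space with basis the multisets satisfy
the same relations, so the Nichols algebra acts there, and this action separates multisets.
Dimensions are thus bounded on both sides by counts of multisets on m letters. -/

/-! ### Closed multiplicative 2-forms on the lattice of multisets -/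

section Potential

variable {X k : Type*} [Field k]

/-- A choice of an element of a nonempty multiset. -/
noncomputable def Multiset.basePoint (ν : Multiset X) (b : X) : X :=
  haveI := Classical.propDecidable
  if h : ∃ a, a ∈ ν then h.choose else b

theorem Multiset.basePoint_mem {ν : Multiset X} {b : X} (h : b ∈ ν) (c : X) :
    ν.basePoint c ∈ ν := by
  have h' : ∃ a, a ∈ ν := ⟨b, h⟩
  rw [Multiset.basePoint, dif_pos h']
  exact h'.choose_spec

theorem Multiset.basePoint_eq {ν : Multiset X} {b : X} (h : b ∈ ν) (c d : X) :
    ν.basePoint c = ν.basePoint d := by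
  have h' : ∃ a, a ∈ ν := ⟨b, h⟩
  rw [Multiset.basePoint, dif_pos h', Multiset.basePoint, dif_pos h']

variable [DecidableEq X]

/-- The weight of the edge from `ν - b` to `ν` in the potential of the closed `2`-form `Q`, in the
gauge where the edge towards the base point of `ν` has weight one. -/
noncomputable def edgeWeight (Q : Multiset X → X → X → k) (ν : Multiset X) (b : X) : k :=
  if _h : b ∈ ν ∧ b ≠ ν.basePoint b then
    -- With z the base point, this solves the square condition over `ν - z - b`, in which the edge
    -- from `ν - z` to `ν` has weight one.
    Q ((ν.erase (ν.basePoint b)).erase b) (ν.basePoint b) b *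
      edgeWeight Q (ν.erase (ν.basePoint b)) b / edgeWeight Q (ν.erase b) (ν.basePoint b)
  else 1
termination_by ν.card
decreasing_by
  · exact Multiset.card_erase_lt_of_mem (Multiset.basePoint_mem _h.1 _)
  · exact Multiset.card_erase_lt_of_mem _h.1

theorem edgeWeight_ne_zero {Q : Multiset X → X → X → k} (h0 : ∀ μ a b, Q μ a b ≠ 0)
    (ν : Multiset X) (b : X) : edgeWeight Q ν b ≠ 0 := by
  induction h : ν.card using Nat.strong_induction_on generalizing ν b with
  | _ n ih =>
    rw [edgeWeight]
    split_ifs with hb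
    · refine div_ne_zero (mul_ne_zero (h0 _ _ _) ?_) ?_
      · exact ih _ (h ▸ Multiset.card_erase_lt_of_mem (Multiset.basePoint_mem hb.1 _)) _ _ rfl
      · exact ih _ (h ▸ Multiset.card_erase_lt_of_mem hb.1) _ _ rfl
    · exact one_ne_zero

/-- Induction on the size of `μ`. If `a` or `b` is the base point z of the top vertex, the square
holds by the definition of the weights. Otherwise `μ = z + ω`; in the cube over `ω` with directions
z, a, b, the three faces at `ω` hold by induction and the two containing the z-edge into the top
hold by definition. Closedness then forces the sixth face. -/
theorem edgeWeight_square {Q : Multiset X → X → X → k} (h0 : ∀ μ a b, Q μ a b ≠ 0)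
    (hself : ∀ μ a, Q μ a a = 1) (hanti : ∀ μ a b, Q μ a b * Q μ b a = 1)
    (hclosed : ∀ μ a b c, Q μ a b * Q (b ::ₘ μ) a c * Q μ b c =
      Q (a ::ₘ μ) b c * Q μ a c * Q (c ::ₘ μ) a b) (μ : Multiset X) (a b : X) :
    edgeWeight Q (a ::ₘ μ) a * edgeWeight Q (b ::ₘ a ::ₘ μ) b =
      Q μ a b * edgeWeight Q (b ::ₘ μ) b * edgeWeight Q (a ::ₘ b ::ₘ μ) a := by
  induction h : μ.card using Nat.strong_induction_on generalizing μ a b with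
  | _ n ih =>
    have hL := edgeWeight_ne_zero h0
    by_cases hab : a = b
    · subst hab
      rw [hself, one_mul]
    obtain ⟨ν, hν⟩ : ∃ ν, ν = b ::ₘ a ::ₘ μ := ⟨_, rfl⟩
    have hν' : a ::ₘ b ::ₘ μ = ν := by rw [hν, Multiset.cons_swap]
    rw [hν', ← hν]
    have hbν : b ∈ ν := by simp [hν]
    have haν : a ∈ ν := by simp [hν]
    obtain ⟨z, hz⟩ : ∃ z, z = ν.basePoint a := ⟨_, rfl⟩
    have hzν : z ∈ ν := hz ▸ Multiset.basePoint_mem hbν _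
    have key : ∀ c ω, ν = z ::ₘ c ::ₘ ω → c ≠ z →
        edgeWeight Q ν c = Q ω z c * edgeWeight Q (c ::ₘ ω) c / edgeWeight Q (z ::ₘ ω) z := by
      intro c ω hc hcz
      have hcν : c ∈ ν := by simp [hc]
      have hbp : ν.basePoint c = z := by rw [hz]; exact Multiset.basePoint_eq hbν _ _
      have e1 : ν.erase z = c ::ₘ ω := by rw [hc, Multiset.erase_cons_head]
      have e2 : ν.erase c = z ::ₘ ω := by
        rw [hc, Multiset.cons_swap, Multiset.erase_cons_head]
      rw [edgeWeight, dif_pos ⟨hcν, by rw [hbp]; exact hcz⟩, hbp, e1, e2,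
        Multiset.erase_cons_head]
    have key0 : edgeWeight Q ν z = 1 := by
      rw [edgeWeight, dif_neg]
      rintro ⟨-, h⟩
      exact h (by rw [hz]; exact Multiset.basePoint_eq hbν _ _)
    by_cases haz : a = z
    · subst haz
      rw [key0, key b μ hν'.symm (Ne.symm hab), mul_one, mul_div_cancel₀ _ (hL _ _)]
    by_cases hbz : b = z
    · subst hbz
      rw [key0, key a μ hν haz, mul_one, mul_div_assoc, mul_div_assoc', mul_div_assoc',
        eq_div_iff (hL _ _)]
      have := hanti μ a b
      linear_combination (-edgeWeight Q (a ::ₘ μ) a * edgeWeight Q (b ::ₘ μ) b) * this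
    · have hzμ : z ∈ μ := by
        rw [hν] at hzν
        simpa [Ne.symm haz, Ne.symm hbz] using hzν
      obtain ⟨ω, rfl⟩ := Multiset.exists_cons_of_mem hzμ
      rw [key a (b ::ₘ ω) (by rw [hν, Multiset.cons_swap a, Multiset.cons_swap b,
          Multiset.cons_swap b]) haz,
        key b (a ::ₘ ω) (by rw [hν, Multiset.cons_swap a, Multiset.cons_swap b]) hbz]
      have hlt : ω.card < n := by rw [← h]; simp
      have i1 := ih _ hlt ω z a rfl
      have i2 := ih _ hlt ω z b rfl
      have i3 := ih _ hlt ω a b rfl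
      have n1 := hL (z ::ₘ a ::ₘ ω) z
      have n2 := hL (z ::ₘ b ::ₘ ω) z
      have n3 := hL (z ::ₘ ω) z
      have n4 := hL (a ::ₘ ω) a
      have n5 := hL (b ::ₘ ω) b
      have hc := hclosed ω z a b
      generalize edgeWeight Q (z ::ₘ a ::ₘ ω) z = L1 at *
      generalize edgeWeight Q (z ::ₘ b ::ₘ ω) z = L2 at *
      generalize edgeWeight Q (z ::ₘ ω) z = L3 at *
      generalize edgeWeight Q (a ::ₘ ω) a = L4 at *
      generalize edgeWeight Q (b ::ₘ ω) b = L5 at *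
      generalize edgeWeight Q (a ::ₘ z ::ₘ ω) a = L6 at *
      generalize edgeWeight Q (b ::ₘ z ::ₘ ω) b = L7 at *
      generalize edgeWeight Q (b ::ₘ a ::ₘ ω) b = L8 at *
      generalize edgeWeight Q (a ::ₘ b ::ₘ ω) a = L9 at *
      generalize Q ω z a = Q1 at *
      generalize Q ω z b = Q2 at *
      generalize Q ω a b = Q3 at *
      generalize Q (a ::ₘ ω) z b = Q4 at *
      generalize Q (b ::ₘ ω) z a = Q5 at *
      generalize Q (z ::ₘ ω) a b = Q6 at *
      have e6 : L6 = Q1 * L4 * L1 / L3 := by rw [eq_div_iff n3]; linear_combination i1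
      have e7 : L7 = Q2 * L5 * L2 / L3 := by rw [eq_div_iff n3]; linear_combination i2
      have e8 : L8 = Q3 * L5 * L9 / L4 := by rw [eq_div_iff n4]; linear_combination i3
      rw [e6, e7, e8]
      field_simp
      linear_combination L9 * hc

/-- A closed `2`-form on the lattice of multisets is exact. -/
theorem exists_potential {Q : Multiset X → X → X → k} (h0 : ∀ μ a b, Q μ a b ≠ 0)
    (hself : ∀ μ a, Q μ a a = 1) (hanti : ∀ μ a b, Q μ a b * Q μ b a = 1)
    (hclosed : ∀ μ a b c, Q μ a b * Q (b ::ₘ μ) a c * Q μ b c =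
      Q (a ::ₘ μ) b c * Q μ a c * Q (c ::ₘ μ) a b) :
    ∃ K : Multiset X → X → k, (∀ μ a, K μ a ≠ 0) ∧
      ∀ μ a b, K μ a * K (a ::ₘ μ) b = Q μ a b * K μ b * K (b ::ₘ μ) a :=
  ⟨fun μ a => edgeWeight Q (a ::ₘ μ) a, fun _ _ => edgeWeight_ne_zero h0 _ _,
    edgeWeight_square h0 hself hanti hclosed⟩

end Potential

theorem Equiv.inv_perm_apply_self {X : Type*} (p : Equiv.Perm X) (x : X) : p⁻¹ (p x) = x :=
  p.symm_apply_apply x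

/-! ### The guitar map -/

namespace YBESolution

variable {X : Type*} {S : YBESolution X}

/-- The permutation `σ_i`. -/
noncomputable def σPerm (hS : S.Nondegenerate) (i : X) : Equiv.Perm X :=
  Equiv.ofBijective (S.σ i) (hS.σ_bijective i)

@[simp] theorem σPerm_apply (hS : S.Nondegenerate) (i j : X) : S.σPerm hS i j = S.σ i j := rfl

theorem σ_σ_τ (hinv : S.Involutive) (i j : X) : S.σ (S.σ i j) (S.τ j i) = i :=
  congrArg Prod.fst (hinv (i, j))

theorem τ_τ_σ (hinv : S.Involutive) (i j : X) : S.τ (S.τ j i) (S.σ i j) = j :=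
  congrArg Prod.snd (hinv (i, j))

theorem braid_apply (S : YBESolution X) (i j l : X) :
    S.σ (S.σ i j) (S.σ (S.τ j i) l) = S.σ i (S.σ j l) ∧
      S.τ (S.σ (S.τ j i) l) (S.σ i j) = S.σ (S.τ (S.σ j l) i) (S.τ l j) ∧
      S.τ l (S.τ j i) = S.τ (S.τ l j) (S.τ (S.σ j l) i) := by
  have h := congrFun S.braid (i, j, l)
  simp only [Function.comp_apply, Prod.ext_iff] at h
  exact h

theorem σPerm_mul (hS : S.Nondegenerate) (i j : X) :
    S.σPerm hS (S.σ i j) * S.σPerm hS (S.τ j i) = S.σPerm hS i * S.σPerm hS j :=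
  Equiv.ext fun l => (S.braid_apply i j l).1

theorem τ_diag (hS : S.Nondegenerate) (i : X) : S.τ i (S.diag hS i) = i :=
  (Equiv.ofBijective (S.τ i) (hS.τ_bijective i)).apply_symm_apply i

theorem σ_diag (hS : S.Nondegenerate) (hinv : S.Involutive) (i : X) :
    S.σ (S.diag hS i) i = S.diag hS i := by
  have h := τ_τ_σ hinv (S.diag hS i) i
  rw [τ_diag] at h
  exact (hS.τ_bijective i).1 (by rw [h, τ_diag])

/-- These are the pairs fixed by r, and also those whose letters coincide after the guitar map. -/
theorem σ_eq_left_iff (hS : S.Nondegenerate) (hinv : S.Involutive) (i j : X) :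
    S.σ i j = i ↔ i = S.diag hS j := by
  refine ⟨fun h => ?_, fun h => by rw [h, σ_diag hS hinv]⟩
  have h1 := σ_σ_τ hinv i j
  rw [h] at h1
  have h2 : S.τ j i = j := (hS.σ_bijective i).1 (by rw [h1, h])
  exact (hS.τ_bijective j).1 (by rw [h2, τ_diag])

/-- The permutation `σ_{x_1} ⋯ σ_{x_n}` in terms of the multiset of letters of the image of the word
`x_1 ⋯ x_n` under the guitar map. -/
noncomputable def frame (hS : S.Nondegenerate) (hinv : S.Involutive) (μ : Multiset X) :
    Equiv.Perm X :=
  haveI : LeftCommutative fun (a : X) (p : Equiv.Perm X) => p * S.σPerm hS (p⁻¹ a) := ⟨by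
    intro a b p
    -- For y = σ_x(z) the left side is σ_x σ_z; passing from (x, z) to r(x, z) preserves this
    -- product and exchanges the roles of x and y.
    have key : ∀ x y : X, S.σPerm hS x * S.σPerm hS ((S.σPerm hS x)⁻¹ y) =
        S.σPerm hS y * S.σPerm hS ((S.σPerm hS y)⁻¹ x) := fun x y => by
      obtain ⟨z, rfl⟩ := (S.σPerm hS x).surjective y
      have h : (S.σPerm hS (S.σ x z))⁻¹ x = S.τ z x := by
        rw [Equiv.Perm.inv_eq_iff_eq, σPerm_apply, σ_σ_τ hinv]
      rw [Equiv.inv_perm_apply_self, σPerm_apply, h, σPerm_mul]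
    simp only [mul_inv_rev, Equiv.Perm.mul_apply, mul_assoc, key]⟩
  μ.foldr (fun a p => p * S.σPerm hS (p⁻¹ a)) 1

section Guitar

variable (hS : S.Nondegenerate) (hinv : S.Involutive)

theorem frame_cons (μ : Multiset X) (x : X) :
    S.frame hS hinv (S.frame hS hinv μ x ::ₘ μ) = S.frame hS hinv μ * S.σPerm hS x := by
  rw [frame, Multiset.foldr_cons, ← frame, Equiv.inv_perm_apply_self]

/-- The guitar map, which conjugates the action of `r` on adjacent letters to the flip; `μ` is the
multiset of letters already read. -/
noncomputable def guitar : Multiset X → List X → List X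
  | _, [] => []
  | μ, x :: t => S.frame hS hinv μ x :: guitar (S.frame hS hinv μ x ::ₘ μ) t

/-- The inverse of the guitar map. -/
noncomputable def unguitar : Multiset X → List X → List X
  | _, [] => []
  | μ, a :: t => (S.frame hS hinv μ)⁻¹ a :: unguitar (a ::ₘ μ) t

theorem unguitar_guitar (μ : Multiset X) (x : List X) :
    unguitar hS hinv μ (guitar hS hinv μ x) = x := by
  induction x generalizing μ with
  | nil => rfl
  | cons a t ih => simp [guitar, unguitar, ih]

theorem guitar_unguitar (μ : Multiset X) (x : List X) :
    guitar hS hinv μ (unguitar hS hinv μ x) = x := by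
  induction x generalizing μ with
  | nil => rfl
  | cons a t ih => simp [guitar, unguitar, ih]

@[simp] theorem length_guitar (μ : Multiset X) (x : List X) :
    (guitar hS hinv μ x).length = x.length := by
  induction x generalizing μ with
  | nil => rfl
  | cons a t ih => simp [guitar, ih]

@[simp] theorem length_unguitar (μ : Multiset X) (x : List X) :
    (unguitar hS hinv μ x).length = x.length := by
  induction x generalizing μ with
  | nil => rfl
  | cons a t ih => simp [unguitar, ih]

theorem guitar_append (μ : Multiset X) (u v : List X) :
    guitar hS hinv μ (u ++ v) =
      guitar hS hinv μ u ++ guitar hS hinv (guitar hS hinv μ u + μ) v := by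
  induction u generalizing μ with
  | nil => simp [guitar]
  | cons a t ih =>
    simp only [List.cons_append, guitar, ih, ← Multiset.cons_coe, Multiset.cons_add,
      Multiset.add_cons]

theorem frame_mul_σPerm_τ (μ : Multiset X) (a b : X) :
    S.frame hS hinv (S.frame hS hinv μ (S.σ a b) ::ₘ μ) (S.τ b a) = S.frame hS hinv μ a := by
  rw [frame_cons, Equiv.Perm.mul_apply, σPerm_apply, σ_σ_τ hinv]

/-- Compared with `guitar_pair_swap`, this shows that r exchanges the two image letters and leaves
the tail alone, since the tail sees only the multiset already read. -/
theorem guitar_pair (μ : Multiset X) (a b : X) (v : List X) :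
    guitar hS hinv μ (a :: b :: v) = S.frame hS hinv μ a :: S.frame hS hinv μ (S.σ a b) ::
      guitar hS hinv (S.frame hS hinv μ a ::ₘ S.frame hS hinv μ (S.σ a b) ::ₘ μ) v := by
  simp only [guitar, frame_cons, Equiv.Perm.mul_apply, σPerm_apply]
  rw [Multiset.cons_swap]

theorem guitar_pair_swap (μ : Multiset X) (a b : X) (v : List X) :
    guitar hS hinv μ (S.σ a b :: S.τ b a :: v) =
      S.frame hS hinv μ (S.σ a b) :: S.frame hS hinv μ a ::
      guitar hS hinv (S.frame hS hinv μ a ::ₘ S.frame hS hinv μ (S.σ a b) ::ₘ μ) v := by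
  simp only [guitar, frame_mul_σPerm_τ]

end Guitar

end YBESolution

/-! ### The coefficients R as a closed 2-form -/

namespace BraidingCoeff

open YBESolution

variable {X k : Type*} [Field k] {S : YBESolution X} {C : BraidingCoeff S k}

/-- The twist of an adjacent pair of letters, in the coordinates of the guitar map. -/
noncomputable def twist (C : BraidingCoeff S k) (hS : S.Nondegenerate) (hinv : S.Involutive)
    (μ : Multiset X) (a b : X) : k :=
  haveI := Classical.propDecidable
  -- Equal letters come from pairs i = D(j), whose coefficient is not gauged away; the value 1 keeps
  -- the form antisymmetric.
  if a = b then 1 else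
    C.R ((S.frame hS hinv μ)⁻¹ a) ((S.frame hS hinv (a ::ₘ μ))⁻¹ b)

variable (hS : S.Nondegenerate) (hinv : S.Involutive)

theorem twist_apply (μ : Multiset X) {a b : X} (hab : a ≠ S.diag hS b) :
    C.twist hS hinv μ (S.frame hS hinv μ a) (S.frame hS hinv μ (S.σ a b)) = C.R a b := by
  have h : S.frame hS hinv μ (S.σ a b) = S.frame hS hinv (S.frame hS hinv μ a ::ₘ μ) b := by
    rw [frame_cons, Equiv.Perm.mul_apply, σPerm_apply]
  have h1 : S.frame hS hinv μ a ≠ S.frame hS hinv μ (S.σ a b) := fun e =>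
    hab ((σ_eq_left_iff hS hinv a b).1 ((S.frame hS hinv μ).injective e).symm)
  rw [twist, if_neg h1, h, Equiv.inv_perm_apply_self, Equiv.inv_perm_apply_self]

/-- The hypothesis `hR` makes `twist` antisymmetric and `compat` makes it closed, so it has a
potential. -/
theorem exists_gauge (hR : ∀ i j, i ≠ S.diag hS j → C.R i j * C.R (S.σ i j) (S.τ j i) = 1) :
    ∃ K : Multiset X → X → k, (∀ μ a, K μ a ≠ 0) ∧
      ∀ μ a b, a ≠ S.diag hS b →
        K μ (S.frame hS hinv μ a) * K (S.frame hS hinv μ a ::ₘ μ) (S.frame hS hinv μ (S.σ a b)) =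
        C.R a b * K μ (S.frame hS hinv μ (S.σ a b)) *
          K (S.frame hS hinv μ (S.σ a b) ::ₘ μ) (S.frame hS hinv μ a) := by
  classical
  have hself : ∀ μ a, C.twist hS hinv μ a a = 1 := fun μ a => by rw [twist, if_pos rfl]
  have hne : ∀ μ a b, C.twist hS hinv μ a b ≠ 0 := fun μ a b => by
    rw [twist]; split_ifs
    exacts [one_ne_zero, C.ne_zero _ _]
  have hanti : ∀ μ a b, C.twist hS hinv μ a b * C.twist hS hinv μ b a = 1 := fun μ a b => by
    by_cases hab : a = b
    · subst hab; rw [hself, one_mul]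
    obtain ⟨x, rfl⟩ := (S.frame hS hinv μ).surjective a
    obtain ⟨y', rfl⟩ := (S.frame hS hinv μ).surjective b
    obtain ⟨y, rfl⟩ := (S.σPerm hS x).surjective y'
    rw [σPerm_apply] at *
    have hxy : x ≠ S.diag hS y := fun e =>
      hab (by rw [(σ_eq_left_iff hS hinv x y).2 e])
    have hxy' : S.σ x y ≠ S.diag hS (S.τ y x) := fun e => by
      rw [← σ_eq_left_iff hS hinv, σ_σ_τ hinv] at e
      exact hab (by rw [← e])
    have h2 := twist_apply (C := C) hS hinv μ hxy'
    rw [σ_σ_τ hinv] at h2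
    rw [twist_apply hS hinv μ hxy, h2, hR _ _ hxy]
  obtain ⟨K, h1, h2⟩ := exists_potential (Q := C.twist hS hinv) hne hself hanti (by
    intro μ a b c
    -- When two directions of the cube coincide, normalization and antisymmetry suffice.
    by_cases hab : a = b
    · subst hab
      simp only [hself, one_mul, mul_one]
    by_cases hbc : b = c
    · subst hbc
      simp only [hself, one_mul, mul_one]
    by_cases hac : a = c
    · subst hac
      have e1 := hanti μ a b
      have e2 := hanti (a ::ₘ μ) a b
      rw [mul_right_comm, e1, hself, hself]
      linear_combination -e2
    -- The letters a, b, c are the guitar image of a word xyz, and the six faces of the cube carry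
    -- the six coefficients of `compat` at (x, y, z). Distinctness excludes the diagonal pairs.
    obtain ⟨x, rfl⟩ := (S.frame hS hinv μ).surjective a
    obtain ⟨y', rfl⟩ := (S.frame hS hinv μ).surjective b
    obtain ⟨y, rfl⟩ := (S.σPerm hS x).surjective y'
    obtain ⟨z₁, rfl⟩ := (S.frame hS hinv μ).surjective c
    obtain ⟨z₂, rfl⟩ := (S.σPerm hS x).surjective z₁
    obtain ⟨z, rfl⟩ := (S.σPerm hS y).surjective z₂
    simp only [σPerm_apply] at *
    have diag_ne : ∀ i j, S.σ i j ≠ i → i ≠ S.diag hS j := fun i j h e =>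
      h ((σ_eq_left_iff hS hinv i j).2 e)
    have inj := fun {i j} (h : S.frame hS hinv μ i ≠ S.frame hS hinv μ j) (e : i = j) =>
      h (congrArg _ e)
    have hb := S.braid_apply x y z
    have t1 := twist_apply (C := C) hS hinv μ (diag_ne x y fun e => inj hab e.symm)
    have f1 : ∀ w, S.frame hS hinv (S.frame hS hinv μ x ::ₘ μ) w =
        S.frame hS hinv μ (S.σ x w) := fun w => by
      rw [frame_cons, Equiv.Perm.mul_apply, σPerm_apply]
    have f2 : ∀ w, S.frame hS hinv (S.frame hS hinv μ (S.σ x y) ::ₘ μ) w =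
        S.frame hS hinv μ (S.σ (S.σ x y) w) := fun w => by
      rw [frame_cons, Equiv.Perm.mul_apply, σPerm_apply]
    have f3 : ∀ w, S.frame hS hinv (S.frame hS hinv μ (S.σ x (S.σ y z)) ::ₘ μ) w =
        S.frame hS hinv μ (S.σ (S.σ x (S.σ y z)) w) := fun w => by
      rw [frame_cons, Equiv.Perm.mul_apply, σPerm_apply]
    have t2 := twist_apply (C := C) hS hinv (S.frame hS hinv μ (S.σ x y) ::ₘ μ)
      (diag_ne (S.τ y x) z fun e => hac (by
        have := congrArg (S.σ (S.σ x y)) e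
        rw [hb.1, σ_σ_τ hinv] at this
        rw [this]))
    rw [f2, f2, hb.1, σ_σ_τ hinv] at t2
    have t3 := twist_apply (C := C) hS hinv μ (a := S.σ x y) (b := S.σ (S.τ y x) z)
      (diag_ne _ _ fun e => hbc (by rw [← hb.1, e]))
    rw [hb.1] at t3
    have t4 := twist_apply (C := C) hS hinv (S.frame hS hinv μ x ::ₘ μ)
      (diag_ne y z fun e => hbc (by rw [e]))
    rw [f1, f1] at t4
    have t5 := twist_apply (C := C) hS hinv μ (a := x) (b := S.σ y z)
      (diag_ne _ _ fun e => hac (by rw [e]))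
    have hxyz : S.σ (S.σ x (S.σ y z)) (S.σ (S.τ (S.σ y z) x) (S.τ z y)) = S.σ x y := by
      rw [(S.braid_apply x (S.σ y z) (S.τ z y)).1, σ_σ_τ hinv]
    have t6 := twist_apply (C := C) hS hinv (S.frame hS hinv μ (S.σ x (S.σ y z)) ::ₘ μ)
      (a := S.τ (S.σ y z) x) (b := S.τ z y)
      (diag_ne _ _ fun e => hab (by
        have := congrArg (S.σ (S.σ x (S.σ y z))) e
        rw [hxyz, σ_σ_τ hinv] at this
        rw [this]))
    rw [f3, f3, hxyz, σ_σ_τ hinv] at t6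
    rw [t1, t2, t3, t4, t5, t6, C.compat])
  refine ⟨K, h1, fun μ a b hab => ?_⟩
  rw [h2, twist_apply hS hinv μ hab]

end BraidingCoeff

/-! ### Quantum integers -/

section QuantumInteger

variable {k : Type*} [Field k]

/-- The quantum integer `[n]_q = 1 + q + ⋯ + q^{n-1}`. -/
def qNumber (q : k) (n : ℕ) : k := ∑ i ∈ Finset.range n, q ^ i

theorem qNumber_succ (q : k) (n : ℕ) : qNumber q (n + 1) = q * qNumber q n + 1 :=
  geom_sum_succ

@[simp] theorem qNumber_zero (q : k) : qNumber q 0 = 0 := Finset.sum_range_zero _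

/-- A zero with q ≠ 1 gives q^{n+1} = 1, so q is a root of unity of order at least 2. For q = 1 the
characteristic decides. -/
theorem qNumber_ne_zero [CharZero k] {q : k} (hroot : ∀ n : ℕ, 2 ≤ n → ¬ IsPrimitiveRoot q n)
    (n : ℕ) : qNumber q (n + 1) ≠ 0 := by
  intro h
  by_cases hq : q = 1
  · subst hq
    simp only [qNumber, one_pow, Finset.sum_const, Finset.card_range, nsmul_eq_mul, mul_one] at h
    exact Nat.cast_ne_zero.2 n.succ_ne_zero h
  · have h1 : q ^ (n + 1) = 1 := by
      have := geom_sum_mul q (n + 1)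
      rw [← qNumber, h, zero_mul] at this
      exact (sub_eq_zero.1 this.symm)
    have hpos : 0 < orderOf q := orderOf_pos_iff.2
      (isOfFinOrder_iff_pow_eq_one.2 ⟨n + 1, by simp, h1⟩)
    have hne : orderOf q ≠ 1 := fun e => hq (orderOf_eq_one_iff.1 e)
    exact hroot (orderOf q) (by omega) (IsPrimitiveRoot.orderOf q)

/-- The product of the quantum factorials of the multiplicities of a multiset. -/
def qMultifactorial {X : Type*} [Fintype X] [DecidableEq X] (q : k) (μ : Multiset X) : k :=
  ∏ a, ∏ i ∈ Finset.range (μ.count a), qNumber q (i + 1)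

variable {X : Type*} [Fintype X] [DecidableEq X]

theorem qMultifactorial_cons (q : k) (a : X) (μ : Multiset X) :
    qMultifactorial q (a ::ₘ μ) = qNumber q (μ.count a + 1) * qMultifactorial q μ := by
  have h : ∀ c, ∏ i ∈ Finset.range ((a ::ₘ μ).count c), qNumber q (i + 1) =
      (if c = a then qNumber q (μ.count a + 1) else 1) *
        ∏ i ∈ Finset.range (μ.count c), qNumber q (i + 1) := fun c => by
    split_ifs with hc
    · subst hc
      rw [Multiset.count_cons_self, Finset.prod_range_succ, mul_comm]
    · rw [Multiset.count_cons_of_ne hc, one_mul]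
  simp only [qMultifactorial, h, Finset.prod_mul_distrib, Finset.prod_ite_eq', Finset.mem_univ,
    if_true]

theorem qNumber_mul_qMultifactorial_erase (q : k) {a : X} {μ : Multiset X} (h : a ∈ μ) :
    qNumber q (μ.count a) * qMultifactorial q (μ.erase a) = qMultifactorial q μ := by
  obtain ⟨ω, rfl⟩ := Multiset.exists_cons_of_mem h
  rw [Multiset.erase_cons_head, qMultifactorial_cons, Multiset.count_cons_self]

theorem qMultifactorial_ne_zero [CharZero k] {q : k}
    (hroot : ∀ n : ℕ, 2 ≤ n → ¬ IsPrimitiveRoot q n) (μ : Multiset X) :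
    qMultifactorial q μ ≠ 0 :=
  Finset.prod_ne_zero_iff.2 fun _ _ => Finset.prod_ne_zero_iff.2 fun _ _ =>
    qNumber_ne_zero hroot _

end QuantumInteger

/-! ### The arrangements of a multiset -/

namespace Multiset

variable {X : Type*} [DecidableEq X]

/-- The finite set of the words with a given multiset of letters. -/
def arrangements (μ : Multiset X) : Finset (List X) := (Multiset.lists μ).toFinset

@[simp] theorem mem_arrangements {μ : Multiset X} {l : List X} :
    l ∈ μ.arrangements ↔ (l : Multiset X) = μ := by
  rw [arrangements, Multiset.mem_toFinset, Multiset.mem_lists_iff]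
  exact eq_comm

theorem sum_arrangements {N : Type*} [AddCommMonoid N] {μ : Multiset X} (hμ : μ ≠ 0)
    (f : List X → N) :
    ∑ y ∈ μ.arrangements, f y =
      ∑ a ∈ μ.toFinset, ∑ y ∈ (μ.erase a).arrangements, f (a :: y) := by
  rw [Finset.sum_sigma']
  symm
  refine Finset.sum_bij (fun s _ => s.1 :: s.2) ?_ ?_ ?_ ?_
  · rintro ⟨a, y⟩ h
    simp only [Finset.mem_sigma, Multiset.mem_toFinset, mem_arrangements] at h
    rw [mem_arrangements, ← Multiset.cons_coe, h.2, Multiset.cons_erase h.1]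
  · rintro ⟨a, y⟩ _ ⟨b, z⟩ _ h
    simp only [List.cons.injEq] at h
    obtain ⟨rfl, rfl⟩ := h
    rfl
  · intro l hl
    rw [mem_arrangements] at hl
    subst hl
    cases l with
    | nil => exact absurd rfl hμ
    | cons a y =>
      refine ⟨⟨a, y⟩, ?_, rfl⟩
      simp
  · intros; rfl

end Multiset

/-! ### The dual of the quantum shuffle -/

section DualShuffle

variable {X k N : Type*} [DecidableEq X] [Field k] [AddCommGroup N] [Module k N]

/-- The sum over the letters `a` of a word of `G a p'`, where `p'` is the word without `a`, weighted
by `q` to the number of letters `a` before the chosen one. -/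
def dualShuffle (q : k) : List X → (X → List X → N) → N
  | [], _ => 0
  | b :: p, G => G b p + dualShuffle q p fun a p' => (if a = b then q else 1) • G a (b :: p')

theorem dualShuffle_congr (q : k) (p : List X) {G G' : X → List X → N}
    (h : ∀ a p', p'.length + 1 = p.length → G a p' = G' a p') :
    dualShuffle q p G = dualShuffle q p G' := by
  induction p generalizing G G' with
  | nil => rfl
  | cons b p ih =>
    rw [dualShuffle, dualShuffle, h b p rfl]
    congr 1
    refine ih fun a p' hp => ?_
    rw [h a (b :: p') (by simp [hp])]

theorem map_dualShuffle {N' : Type*} [AddCommGroup N'] [Module k N'] (q : k) (p : List X)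
    (G : X → List X → N) (f : N →ₗ[k] N') :
    f (dualShuffle q p G) = dualShuffle q p fun a p' => f (G a p') := by
  induction p generalizing G with
  | nil => simp [dualShuffle]
  | cons b p ih => simp only [dualShuffle, map_add, ih, map_smul]

/-- The n copies of a letter are preceded by 0, …, n − 1 copies of it, and removing any of them
leaves the same multiset, so their weights add up to [n]_q. -/
theorem dualShuffle_eq_sum [Fintype X] (q : k) (p : List X) (G : X → Multiset X → N) :
    dualShuffle q p (fun a p' => G a p') =
      ∑ a, qNumber q ((p : Multiset X).count a) • G a ((p : Multiset X).erase a) := by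
  induction p generalizing G with
  | nil => simp [dualShuffle]
  | cons b p ih =>
    rw [dualShuffle]
    have := ih fun a μ => (if a = b then q else 1) • G a (b ::ₘ μ)
    simp only [Multiset.cons_coe] at this
    rw [this, ← Multiset.cons_coe]
    have h1 : G b p = ∑ a, if a = b then G b p else 0 := by simp
    rw [h1, ← Finset.sum_add_distrib]
    refine Finset.sum_congr rfl fun a _ => ?_
    by_cases hab : a = b
    · subst hab
      simp only [if_true, Multiset.count_cons_self, Multiset.erase_cons_head, qNumber_succ]
      by_cases ha : a ∈ (p : Multiset X)
      · rw [Multiset.cons_erase ha, smul_smul, add_comm, add_smul, one_smul, mul_comm]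
      · rw [Multiset.count_eq_zero_of_notMem ha]
        simp
    · rw [if_neg hab, if_neg hab, zero_add, one_smul, Multiset.count_cons_of_ne hab,
        Multiset.erase_cons_tail _ (Ne.symm hab)]

end DualShuffle

/-! ### The quantum symmetrizer in guitar coordinates -/

namespace BraidingCoeff

open YBESolution Nichols

variable {X k : Type*} [Field k] {S : YBESolution X} (C : BraidingCoeff S k)
variable (hS : S.Nondegenerate) (hinv : S.Involutive)

/-- A choice of edge weights relative to which the braiding becomes, in the coordinates of the
guitar map, a rescaled flip. -/
def IsGauge (K : Multiset X → X → k) : Prop :=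
  (∀ μ a, K μ a ≠ 0) ∧
    ∀ μ a b, a ≠ S.diag hS b →
      K μ (S.frame hS hinv μ a) * K (S.frame hS hinv μ a ::ₘ μ) (S.frame hS hinv μ (S.σ a b)) =
        C.R a b * K μ (S.frame hS hinv μ (S.σ a b)) *
          K (S.frame hS hinv μ (S.σ a b) ::ₘ μ) (S.frame hS hinv μ a)

/-- The product of the edge weights along a word. -/
noncomputable def wordWeight (K : Multiset X → X → k) : Multiset X → List X → k
  | _, [] => 1
  | μ, x :: t => K μ (S.frame hS hinv μ x) * wordWeight K (S.frame hS hinv μ x ::ₘ μ) t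

variable {C hS hinv}
variable {K : Multiset X → X → k}

theorem wordWeight_ne_zero (hK : C.IsGauge hS hinv K) (μ : Multiset X) (x : List X) :
    wordWeight hS hinv K μ x ≠ 0 := by
  induction x generalizing μ with
  | nil => exact one_ne_zero
  | cons a t ih => exact mul_ne_zero (hK.1 _ _) (ih _)

theorem wordWeight_append (μ : Multiset X) (u v : List X) :
    wordWeight hS hinv K μ (u ++ v) =
      wordWeight hS hinv K μ u * wordWeight hS hinv K (guitar hS hinv μ u + μ) v := by
  induction u generalizing μ with
  | nil => simp [guitar, wordWeight]
  | cons a t ih =>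
    simp only [List.cons_append, guitar, wordWeight, ih, ← Multiset.cons_coe, Multiset.cons_add,
      Multiset.add_cons, mul_assoc]

theorem wordWeight_swap (hK : C.IsGauge hS hinv K) (μ : Multiset X) (u : List X) {a b : X}
    (v : List X) (hab : a ≠ S.diag hS b) :
    wordWeight hS hinv K μ (u ++ a :: b :: v) =
      C.R a b * wordWeight hS hinv K μ (u ++ S.σ a b :: S.τ b a :: v) := by
  rw [wordWeight_append, wordWeight_append]
  simp only [wordWeight, frame_mul_σPerm_τ]
  rw [frame_cons, Equiv.Perm.mul_apply, σPerm_apply, Multiset.cons_swap]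
  have := hK.2 (guitar hS hinv μ u + μ) a b hab
  linear_combination (wordWeight hS hinv K μ u * wordWeight hS hinv K
    (S.frame hS hinv (guitar hS hinv μ u + μ) a ::ₘ
      S.frame hS hinv (guitar hS hinv μ u + μ) (S.σ a b) ::ₘ (guitar hS hinv μ u + μ)) v) * this

variable [DecidableEq X]

variable (hS hinv K) in
/-- The coefficient of the word `z`, in the coordinates of the guitar map and the gauge `K`. -/
noncomputable def wordCoeff (z x : List X) : k :=
  if guitar hS hinv 0 x = z then wordWeight hS hinv K 0 x else 0

/-- Here the braiding becomes the weighted flip: for equal letters r fixes the pair and R is `q`;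
for unequal ones the gauge absorbs R. -/
theorem wordCoeff_swap (hK : C.IsGauge hS hinv K) {q : k} (hq : ∀ i, C.R (S.diag hS i) i = q)
    {u u' : List X} (hu : u'.length = u.length) (a b a' b' : X) (v v' : List X) :
    C.R a' b' * wordCoeff hS hinv K (u ++ a :: b :: v) (u' ++ S.σ a' b' :: S.τ b' a' :: v') =
      (if a = b then q else 1) * wordCoeff hS hinv K (u ++ b :: a :: v) (u' ++ a' :: b' :: v') := by
  have e1 := guitar_append hS hinv 0 u' (a' :: b' :: v')
  have e2 := guitar_append hS hinv 0 u' (S.σ a' b' :: S.τ b' a' :: v')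
  rw [guitar_pair] at e1
  rw [guitar_pair_swap] at e2
  have hlen : (guitar hS hinv 0 u').length = u.length := by rw [length_guitar, hu]
  have iff1 : guitar hS hinv 0 (u' ++ a' :: b' :: v') = u ++ b :: a :: v ↔
      guitar hS hinv 0 (u' ++ S.σ a' b' :: S.τ b' a' :: v') = u ++ a :: b :: v := by
    have key : ∀ w w', guitar hS hinv 0 u' ++ w = u ++ w' ↔ guitar hS hinv 0 u' = u ∧ w = w' :=
      fun w w' => ⟨fun h => List.append_inj h hlen, fun h => by rw [h.1, h.2]⟩
    rw [e1, e2, key, key]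
    simp only [List.cons.injEq]
    tauto
  by_cases h : guitar hS hinv 0 (u' ++ S.σ a' b' :: S.τ b' a' :: v') = u ++ a :: b :: v
  · rw [wordCoeff, wordCoeff, if_pos h, if_pos (iff1.2 h)]
    rw [e2] at h
    have h' := (List.append_inj h hlen).2
    simp only [List.cons.injEq] at h'
    obtain ⟨h1, h2, -⟩ := h'
    by_cases hab : a' = S.diag hS b'
    · subst hab
      rw [σ_diag hS hinv] at h1
      rw [← h1, ← h2, if_pos rfl, hq, σ_diag hS hinv, τ_diag]
    · have : a ≠ b := fun e => hab ((σ_eq_left_iff hS hinv _ _).1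
        ((S.frame hS hinv _).injective (h1.trans (e.trans h2.symm))))
      rw [if_neg this, one_mul, wordWeight_swap hK 0 u' v' hab]
  · rw [wordCoeff, wordCoeff, if_neg h, if_neg (fun e => h (iff1.1 e)), mul_zero, mul_zero]

/-- The basis of words of the tensor power `W^{⊗n}`. -/
noncomputable def wordBasis (X k : Type*) [Field k] (n : ℕ) :
    Module.Basis (Fin n → X) k (⨂[k]^n (X →₀ k)) :=
  Basis.piTensorProduct fun _ => Finsupp.basisSingleOne

omit [DecidableEq X] in
theorem wordBasis_apply (n : ℕ) (x : Fin n → X) :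
    wordBasis X k n x = PiTensorProduct.tprod k fun l => Finsupp.single (x l) (1 : k) := by
  simp [wordBasis]

variable (hS hinv K) in
/-- The functional on `W^{⊗n}` with values `wordCoeff` on words. -/
noncomputable def coeffFunctional (n : ℕ) (z : List X) : Module.Dual k (⨂[k]^n (X →₀ k)) :=
  (wordBasis X k n).constr k fun x => wordCoeff hS hinv K z (List.ofFn x)

theorem coeffFunctional_wordBasis (n : ℕ) (z : List X) (x : Fin n → X) :
    coeffFunctional hS hinv K n z (wordBasis X k n x) = wordCoeff hS hinv K z (List.ofFn x) :=
  (wordBasis X k n).constr_basis k _ _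

theorem coeffFunctional_eq_zero {n : ℕ} {z : List X} (h : z.length ≠ n) :
    coeffFunctional hS hinv K n z = 0 := by
  refine (wordBasis X k n).ext fun x => ?_
  rw [coeffFunctional_wordBasis, wordCoeff, if_neg, LinearMap.zero_apply]
  rintro rfl
  simp at h

omit [DecidableEq X] in
theorem ofFn_update {n : ℕ} (x : Fin n → X) (i : Fin n) (a : X) :
    List.ofFn (Function.update x i a) = (List.ofFn x).set i a := by
  refine List.ext_getElem (by simp) fun j h1 h2 => ?_
  simp only [List.getElem_ofFn, List.getElem_set, Function.update_apply, Fin.ext_iff, eq_comm]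

omit [DecidableEq X] in
theorem braidAt_wordBasis {n i : ℕ} (h : i + 1 < n) (x : Fin n → X) :
    braidAt C.braiding.c.toLinearMap n i (wordBasis X k n x) =
      C.R (x ⟨i, Nat.lt_of_succ_lt h⟩) (x ⟨i + 1, h⟩) • wordBasis X k n
        (Function.update (Function.update x ⟨i, Nat.lt_of_succ_lt h⟩
          (S.σ (x ⟨i, Nat.lt_of_succ_lt h⟩) (x ⟨i + 1, h⟩)))
          ⟨i + 1, h⟩ (S.τ (x ⟨i + 1, h⟩) (x ⟨i, Nat.lt_of_succ_lt h⟩))) := by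
  rw [braidAt, dif_pos h, wordBasis_apply, wordBasis_apply, applyAt, PiTensorProduct.lift.tprod]
  change place _ _ (by simp [Fin.ext_iff]) _ (C.cMap _) = _
  rw [cMap_single, map_smul, place_tmul]
  congr 2
  ext1 l
  simp only [Function.update_apply]
  split_ifs <;> rfl

omit [DecidableEq X] in
theorem exists_ofFn_eq {n i : ℕ} (h : i + 1 < n) (x : Fin n → X) :
    ∃ u v : List X, u.length = i ∧
      List.ofFn x = u ++ x ⟨i, Nat.lt_of_succ_lt h⟩ :: x ⟨i + 1, h⟩ :: v ∧
      ∀ a b, List.ofFn (Function.update (Function.update x ⟨i, Nat.lt_of_succ_lt h⟩ a)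
          ⟨i + 1, h⟩ b) = u ++ a :: b :: v := by
  have hu : ((List.ofFn x).take i).length = i := by simp; omega
  have e : List.ofFn x = (List.ofFn x).take i ++ x ⟨i, Nat.lt_of_succ_lt h⟩ ::
      x ⟨i + 1, h⟩ :: (List.ofFn x).drop (i + 2) := by
    conv_lhs => rw [← List.take_append_drop i (List.ofFn x)]
    rw [List.drop_eq_getElem_cons (by simp; omega), List.drop_eq_getElem_cons (by simp; omega)]
    simp
  refine ⟨(List.ofFn x).take i, (List.ofFn x).drop (i + 2), hu, e, fun a b => ?_⟩
  rw [ofFn_update, ofFn_update, e]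
  generalize (List.ofFn x).take i = u at *
  generalize (List.ofFn x).drop (i + 2) = v at *
  subst hu
  simp

theorem coeffFunctional_comp_braidAt (hK : C.IsGauge hS hinv K) {q : k}
    (hq : ∀ i, C.R (S.diag hS i) i = q) (n : ℕ) {i : ℕ} {u : List X} (hu : u.length = i)
    (a b : X) (v : List X) :
    coeffFunctional hS hinv K n (u ++ a :: b :: v) ∘ₗ braidAt C.braiding.c.toLinearMap n i =
      (if a = b then q else 1) • coeffFunctional hS hinv K n (u ++ b :: a :: v) := by
  by_cases h : i + 1 < n
  · refine (wordBasis X k n).ext fun x => ?_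
    obtain ⟨u', v', hu', e1, e2⟩ := exists_ofFn_eq h x
    rw [LinearMap.comp_apply, braidAt_wordBasis h, map_smul, coeffFunctional_wordBasis, e2,
      LinearMap.smul_apply, coeffFunctional_wordBasis, e1, smul_eq_mul, smul_eq_mul,
      wordCoeff_swap hK hq (hu'.trans hu.symm)]
  -- The words have more than `n` letters, so both functionals vanish and no bound on `i` is
  -- required.
  · rw [coeffFunctional_eq_zero, coeffFunctional_eq_zero, smul_zero, LinearMap.zero_comp] <;>
      · simp; omega

/-- The transpose moves each letter of the prefix to the prefix's last place, with a factor `q` for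
each equal letter passed. The prefix is reversed because `shuffleSum` recurses from its last
position. -/
theorem coeffFunctional_comp_shuffleSum (hK : C.IsGauge hS hinv K) {q : k}
    (hq : ∀ i, C.R (S.diag hS i) i = q) (n : ℕ) (b : X) (p t : List X) :
    coeffFunctional hS hinv K n ((b :: p).reverse ++ t) ∘ₗ
        shuffleSum C.braiding.c.toLinearMap n p.length =
      dualShuffle q (b :: p) fun a p' => coeffFunctional hS hinv K n (p'.reverse ++ a :: t) := by
  induction p generalizing b t with
  | nil => simp [shuffleSum, dualShuffle, Module.End.one_eq_id]
  | cons c p ih =>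
    rw [List.length_cons, shuffleSum, dualShuffle, LinearMap.comp_add, Module.End.one_eq_id,
      LinearMap.comp_id, Module.End.mul_eq_comp, ← LinearMap.comp_assoc]
    have e : (b :: c :: p).reverse ++ t = (c :: p).reverse ++ b :: t := by simp
    rw [e, ih]
    congr 1
    have := map_dualShuffle q (c :: p)
      (fun a p' => coeffFunctional hS hinv K n (p'.reverse ++ a :: b :: t))
      (LinearMap.lcomp k k (braidAt C.braiding.c.toLinearMap n p.length))
    rw [LinearMap.lcomp_apply'] at this
    rw [this]
    refine dualShuffle_congr q _ fun a p' hp => ?_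
    rw [LinearMap.lcomp_apply', coeffFunctional_comp_braidAt hK hq n (by simpa using hp)]
    simp

/-- After a letter is moved last, the induction hypothesis depends only on the multiset of the
others. The dual shuffle then yields quantum integers, which build up the factorials, while the
choice of last letter enumerates the arrangements. -/
theorem coeffFunctional_comp_partialSymmetrizer [Fintype X] (hK : C.IsGauge hS hinv K) {q : k}
    (hq : ∀ i, C.R (S.diag hS i) i = q) (n : ℕ) (p t : List X) :
    coeffFunctional hS hinv K n (p.reverse ++ t) ∘ₗ
        partialSymmetrizer C.braiding.c.toLinearMap n p.length =
      qMultifactorial q (p : Multiset X) • ∑ y ∈ (p : Multiset X).arrangements,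
        coeffFunctional hS hinv K n (y.reverse ++ t) := by
  induction hl : p.length generalizing p t with
  | zero =>
    obtain rfl := List.length_eq_zero_iff.1 hl
    have : (((0 : Multiset X)).arrangements) = {[]} := by ext; simp
    simp [partialSymmetrizer, qMultifactorial, Module.End.one_eq_id, this]
  | succ l ih =>
    cases p with
    | nil => simp at hl
    | cons b p =>
      have hp : p.length = l := by simpa using hl
      rw [partialSymmetrizer, Module.End.mul_eq_comp, ← LinearMap.comp_assoc, ← hp,
        coeffFunctional_comp_shuffleSum hK hq]
      have := map_dualShuffle q (b :: p)
        (fun a p' => coeffFunctional hS hinv K n (p'.reverse ++ a :: t))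
        (LinearMap.lcomp k k (partialSymmetrizer C.braiding.c.toLinearMap n p.length))
      rw [LinearMap.lcomp_apply'] at this
      rw [this]
      refine (dualShuffle_congr q (b :: p) fun a p' hp' => ?_).trans
        ((dualShuffle_eq_sum q (b :: p) fun a μ => qMultifactorial q μ • ∑ y ∈ μ.arrangements,
          coeffFunctional hS hinv K n (y.reverse ++ a :: t)).trans ?_)
      · rw [LinearMap.lcomp_apply', hp]
        exact ih p' _ (by simpa [hp] using hp')
      rw [Multiset.sum_arrangements (by simp), Finset.smul_sum]
      symm
      refine Finset.sum_subset_zero_on_sdiff (Finset.subset_univ _) ?_ ?_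
      · intro a ha
        rw [Finset.mem_sdiff, Multiset.mem_toFinset] at ha
        rw [Multiset.count_eq_zero_of_notMem ha.2, qNumber_zero, zero_smul]
      · intro a ha
        rw [Multiset.mem_toFinset] at ha
        rw [smul_smul, qNumber_mul_qMultifactorial_erase q ha]
        simp

/-- The coefficients of an element of the kernel of the quantum symmetrizer sum to zero over every
orbit. -/
theorem sum_coeffFunctional_eq_zero [Fintype X] [CharZero k] (hK : C.IsGauge hS hinv K) {q : k}
    (hq : ∀ i, C.R (S.diag hS i) i = q) (hroot : ∀ n : ℕ, 2 ≤ n → ¬ IsPrimitiveRoot q n) {n : ℕ}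
    {v : ⨂[k]^n (X →₀ k)} (hv : symmetrizer C.braiding.c.toLinearMap n v = 0) {μ : Multiset X}
    (hμ : μ.card = n) :
    ∑ y ∈ μ.arrangements, coeffFunctional hS hinv K n y v = 0 := by
  obtain ⟨p, rfl⟩ : ∃ p : List X, (p : Multiset X) = μ := ⟨μ.toList, μ.coe_toList⟩
  have h := LinearMap.congr_fun (coeffFunctional_comp_partialSymmetrizer hK hq n p []) v
  have hp : p.length = n := hμ
  rw [LinearMap.comp_apply, hp, ← symmetrizer, hv, map_zero, LinearMap.smul_apply, eq_comm,
    smul_eq_zero, or_iff_right (qMultifactorial_ne_zero hroot _), LinearMap.sum_apply] at h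
  rw [← h]
  refine Finset.sum_bij (fun y _ => y.reverse) ?_ ?_ ?_ ?_
  · intro y hy
    rw [Multiset.mem_arrangements] at hy ⊢
    rw [Multiset.coe_reverse, hy]
  · intro a _ b _ h
    exact List.reverse_injective h
  · intro y hy
    rw [Multiset.mem_arrangements] at hy
    exact ⟨y.reverse, by rw [Multiset.mem_arrangements, Multiset.coe_reverse, hy], by simp⟩
  · intro y _
    simp

end BraidingCoeff

/-! ### Words modulo the quadratic relations -/

theorem List.Perm.eq_of_swap_invariant {X N : Type*} {H : List X → N}
    (hH : ∀ u a b v, H (u ++ a :: b :: v) = H (u ++ b :: a :: v)) {l l' : List X}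
    (h : l.Perm l') : H l = H l' := by
  suffices ∀ u, H (u ++ l) = H (u ++ l') from this []
  induction h with
  | nil => exact fun _ => rfl
  | cons a _ ih => exact fun u => by simpa using ih (u ++ [a])
  | swap a b l => exact fun u => hH u b a l
  | trans _ _ ih₁ ih₂ => exact fun u => (ih₁ u).trans (ih₂ u)

namespace YBESolution

variable {X : Type*} {S : YBESolution X} (hS : S.Nondegenerate) (hinv : S.Involutive)

theorem unguitar_append (μ : Multiset X) (u v : List X) :
    unguitar hS hinv μ (u ++ v) = unguitar hS hinv μ u ++ unguitar hS hinv (u + μ) v := by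
  induction u generalizing μ with
  | nil => simp [unguitar]
  | cons a t ih =>
    simp only [List.cons_append, unguitar, ih, ← Multiset.cons_coe, Multiset.cons_add,
      Multiset.add_cons]

theorem exists_guitar_pair (μ : Multiset X) (a b : X) (v : List X) :
    ∃ a' b' v', unguitar hS hinv μ (a :: b :: v) = a' :: b' :: v' ∧
      unguitar hS hinv μ (b :: a :: v) = S.σ a' b' :: S.τ b' a' :: v' := by
  refine ⟨_, _, _, rfl, ?_⟩
  obtain ⟨x, rfl⟩ := (S.frame hS hinv μ).surjective a
  obtain ⟨y, rfl⟩ := (S.frame hS hinv (S.frame hS hinv μ x ::ₘ μ)).surjective b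
  rw [Equiv.inv_perm_apply_self, Equiv.inv_perm_apply_self]
  refine (congrArg (unguitar hS hinv μ) ?_).trans (unguitar_guitar hS hinv μ _)
  rw [guitar_pair_swap]
  have h : S.frame hS hinv (S.frame hS hinv μ x ::ₘ μ) y = S.frame hS hinv μ (S.σ x y) := by
    rw [frame_cons, Equiv.Perm.mul_apply, σPerm_apply]
  rw [h, Multiset.cons_swap, guitar_unguitar]

end YBESolution

namespace BraidingCoeff

open YBESolution Nichols

variable {X k : Type*} [Field k] {S : YBESolution X} {C : BraidingCoeff S k}
variable {hS : S.Nondegenerate} {hinv : S.Involutive} {K : Multiset X → X → k}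

variable (C hS) in
/-- The quadratic relations `f_a f_b = R_{a,b} f_{σ_a(b)} f_{τ_b(a)}` for `a ≠ D(b)`. -/
def QuadraticRelations {B : Type*} [Ring B] [Algebra k B] (f : X → B) : Prop :=
  ∀ a b, a ≠ S.diag hS b → f a * f b = C.R a b • (f (S.σ a b) * f (S.τ b a))

/-- Under the quadratic relations a word depends, up to its weight, only on the multiset of letters
of its image under the guitar map. -/
theorem QuadraticRelations.exists_prod_eq (hK : C.IsGauge hS hinv K) {B : Type*} [Ring B]
    [Algebra k B] {f : X → B} (hf : C.QuadraticRelations hS f) :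
    ∃ h : Multiset X → B, ∀ x : List X,
      (x.map f).prod = wordWeight hS hinv K 0 x • h (guitar hS hinv 0 x) := by
  let H : List X → B := fun z =>
    (wordWeight hS hinv K 0 (unguitar hS hinv 0 z))⁻¹ • ((unguitar hS hinv 0 z).map f).prod
  have hH : ∀ u a b v, H (u ++ a :: b :: v) = H (u ++ b :: a :: v) := fun u a b v => by
    obtain ⟨a', b', v', e1, e2⟩ := exists_guitar_pair hS hinv (u + 0) a b v
    simp only [H, unguitar_append, e1, e2]
    -- For a diagonal pair r fixes it, so both words are the same and no relation is used.
    by_cases hab : a' = S.diag hS b'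
    · subst hab
      rw [σ_diag hS hinv, τ_diag]
    · rw [wordWeight_swap hK _ _ _ hab]
      simp only [List.map_append, List.prod_append, List.map_cons, List.prod_cons]
      rw [← mul_assoc (f a'), hf a' b' hab, mul_inv, mul_comm, mul_smul, smul_mul_assoc,
        mul_smul_comm, inv_smul_smul₀ (C.ne_zero _ _), mul_assoc]
  refine ⟨fun μ => H μ.toList, fun x => ?_⟩
  have h1 : H (guitar hS hinv 0 x : Multiset X).toList = H (guitar hS hinv 0 x) :=
    (Multiset.coe_eq_coe.1 (Multiset.coe_toList _)).eq_of_swap_invariant hH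
  simp only [h1]
  simp only [H, unguitar_guitar]
  rw [smul_inv_smul₀ (wordWeight_ne_zero hK _ _)]

theorem toTensorAlgebra_wordBasis (n : ℕ) (x : Fin n → X) :
    TensorPower.toTensorAlgebra (wordBasis X k n x) =
      ((List.ofFn x).map fun a => TensorAlgebra.ι k (Finsupp.single a (1 : k))).prod := by
  rw [wordBasis_apply, TensorPower.toTensorAlgebra_tprod, TensorAlgebra.tprod_apply, List.map_ofFn]
  rfl

/-- An algebra homomorphism respecting the quadratic relations vanishes on the kernels of the
quantum symmetrizers. -/
theorem QuadraticRelations.map_eq_zero [Fintype X] [CharZero k] (hK : C.IsGauge hS hinv K) {q : k}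
    (hq : ∀ i, C.R (S.diag hS i) i = q) (hroot : ∀ n : ℕ, 2 ≤ n → ¬ IsPrimitiveRoot q n)
    {B : Type*} [Ring B] [Algebra k B] (F : TensorAlgebra k (X →₀ k) →ₐ[k] B)
    (hF : C.QuadraticRelations hS fun a => F (TensorAlgebra.ι k (Finsupp.single a 1)))
    {n : ℕ} {v : ⨂[k]^n (X →₀ k)} (hv : symmetrizer C.braiding.c.toLinearMap n v = 0) :
    F (TensorPower.toTensorAlgebra v) = 0 := by
  classical
  obtain ⟨h, hh⟩ := hF.exists_prod_eq hK
  -- Words are grouped by the multiset of their guitar image. The coefficient of each `h μ` is an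
  -- orbit sum, which vanishes on the kernel.
  have key : F.toLinearMap ∘ₗ TensorPower.toTensorAlgebra =
      ∑ μ : Sym X n, (∑ y ∈ (μ : Multiset X).arrangements,
        coeffFunctional hS hinv K n y).smulRight (h μ) := by
    refine (wordBasis X k n).ext fun x => ?_
    rw [LinearMap.comp_apply, toTensorAlgebra_wordBasis, AlgHom.toLinearMap_apply, map_list_prod,
      List.map_map]
    refine (hh (List.ofFn x)).trans ?_
    rw [LinearMap.sum_apply, Finset.sum_eq_single ⟨guitar hS hinv 0 (List.ofFn x), by simp⟩]
    · simp only [LinearMap.smulRight_apply, LinearMap.sum_apply, coeffFunctional_wordBasis,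
        wordCoeff, Finset.sum_ite_eq, Multiset.mem_arrangements]
      simp
    · intro μ _ hμ
      simp only [LinearMap.smulRight_apply, LinearMap.sum_apply, coeffFunctional_wordBasis,
        wordCoeff, Finset.sum_ite_eq, Multiset.mem_arrangements]
      rw [if_neg, zero_smul]
      exact fun e => hμ (Subtype.ext e.symm)
    · exact fun h => absurd (Finset.mem_univ _) h
  have := LinearMap.congr_fun key v
  rw [LinearMap.comp_apply, AlgHom.toLinearMap_apply] at this
  rw [this, LinearMap.sum_apply]
  refine Finset.sum_eq_zero fun μ _ => ?_
  rw [LinearMap.smulRight_apply, LinearMap.sum_apply]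
  exact (congrArg (· • h μ) (sum_coeffFunctional_eq_zero hK hq hroot hv μ.2)).trans (zero_smul _ _)

/-! ### The generators of the Nichols algebra -/

variable (C) in
/-- The generator `w_a` of the Nichols algebra. -/
noncomputable def generator (a : X) : NicholsAlgebra C.braiding :=
  RingQuot.mkAlgHom k (Nichols.Rel C.braiding) (TensorAlgebra.ι k (Finsupp.single a 1))

theorem symmetrizer_two {V : Type*} [AddCommGroup V] [Module k V]
    (c : (V ⊗[k] V) →ₗ[k] (V ⊗[k] V)) (v : ⨂[k]^2 V) :
    symmetrizer c 2 v = v + braidAt c 2 0 v := by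
  simp [symmetrizer, partialSymmetrizer, shuffleSum]

/-- The braiding maps the words ab and r(a, b) to multiples of each other, with product of
coefficients 1. The claimed difference is negated by c, hence killed by 𝔖_2 = 1 + c. -/
theorem quadraticRelations_generator
    (hR : ∀ i j, i ≠ S.diag hS j → C.R i j * C.R (S.σ i j) (S.τ j i) = 1)
    (hinv : S.Involutive) : C.QuadraticRelations hS C.generator := by
  intro a b hab
  have hu : ∀ c d a b : X, Function.update (Function.update ![c, d] (⟨0, by simp⟩ : Fin 2) a)
      ⟨0 + 1, by simp⟩ b = ![a, b] := fun c d a b => by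
    ext i; fin_cases i <;> rfl
  have h1 := braidAt_wordBasis (C := C) (n := 2) (i := 0) (by simp) ![a, b]
  have h2 := braidAt_wordBasis (C := C) (n := 2) (i := 0) (by simp) ![S.σ a b, S.τ b a]
  rw [hu] at h1 h2
  simp only [Fin.mk_zero, zero_add, Fin.mk_one, Matrix.cons_val_zero, Matrix.cons_val_one,
    σ_σ_τ hinv, τ_τ_σ hinv] at h1 h2
  have h3 : symmetrizer C.braiding.c.toLinearMap 2
      (wordBasis X k 2 ![a, b] - C.R a b • wordBasis X k 2 ![S.σ a b, S.τ b a]) = 0 := by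
    rw [symmetrizer_two, map_sub, map_smul, h1, h2, smul_smul, hR a b hab, one_smul]
    abel
  have h4 := RingQuot.mkAlgHom_rel k (Nichols.Rel.of (B := C.braiding) 2 _ h3)
  rw [map_sub, map_smul, toTensorAlgebra_wordBasis, toTensorAlgebra_wordBasis, map_zero, map_sub,
    sub_eq_zero, map_smul] at h4
  simpa [generator] using h4

/-! ### Word filtration and upper bound on its dimension -/

variable (C) in
/-- The span of the words of length at most `d` in the Nichols algebra. -/
noncomputable def wordFiltration (d : ℕ) : Submodule k (NicholsAlgebra C.braiding) :=
  Submodule.span k {a | ∃ x : List X, x.length ≤ d ∧ (x.map C.generator).prod = a}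

theorem wordFiltration_mono {d e : ℕ} (h : d ≤ e) : C.wordFiltration d ≤ C.wordFiltration e :=
  Submodule.span_mono fun _ ⟨x, hx, e⟩ => ⟨x, hx.trans h, e⟩

theorem wordFiltration_mul (d e : ℕ) :
    C.wordFiltration d * C.wordFiltration e ≤ C.wordFiltration (d + e) := by
  rw [wordFiltration, wordFiltration, Submodule.span_mul_span]
  refine Submodule.span_mono ?_
  rintro _ ⟨_, ⟨x, hx, rfl⟩, _, ⟨y, hy, rfl⟩, rfl⟩
  exact ⟨x ++ y, by simp; omega, by simp⟩

theorem one_mem_wordFiltration (d : ℕ) : 1 ∈ C.wordFiltration d :=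
  Submodule.subset_span ⟨[], by simp, rfl⟩

theorem pow_le_wordFiltration {d : ℕ} {U : Submodule k (NicholsAlgebra C.braiding)}
    (hU : U ≤ C.wordFiltration d) (i : ℕ) : U ^ i ≤ C.wordFiltration (d * i) := by
  induction i with
  | zero => rw [pow_zero, Submodule.one_le]; exact one_mem_wordFiltration _
  | succ i ih =>
    rw [pow_succ]
    exact (mul_le_mul' ih hU).trans (wordFiltration_mul _ _)

theorem exists_mem_wordFiltration (a : NicholsAlgebra C.braiding) :
    ∃ d, a ∈ C.wordFiltration d := by
  obtain ⟨t, rfl⟩ := RingQuot.mkAlgHom_surjective k (Nichols.Rel C.braiding) a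
  induction t using TensorAlgebra.induction with
  | algebraMap r =>
    refine ⟨0, ?_⟩
    rw [AlgHom.commutes, Algebra.algebraMap_eq_smul_one]
    exact Submodule.smul_mem _ _ (one_mem_wordFiltration _)
  | ι w =>
    refine ⟨1, ?_⟩
    induction w using Finsupp.induction_linear with
    | zero => simp
    | add v w hv hw => rw [map_add, map_add]; exact add_mem hv hw
    | single i r =>
      rw [← mul_one r, ← smul_eq_mul, ← Finsupp.smul_single, map_smul, map_smul]
      exact Submodule.smul_mem _ _ (Submodule.subset_span ⟨[i], by simp, by simp [generator]⟩)
  | mul a b ha hb =>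
    obtain ⟨d, hd⟩ := ha
    obtain ⟨e, he⟩ := hb
    exact ⟨d + e, by rw [map_mul]; exact wordFiltration_mul _ _ (Submodule.mul_mem_mul hd he)⟩
  | add a b ha hb =>
    obtain ⟨d, hd⟩ := ha
    obtain ⟨e, he⟩ := hb
    refine ⟨d + e, ?_⟩
    rw [map_add]
    exact add_mem (wordFiltration_mono (by omega) hd) (wordFiltration_mono (by omega) he)

theorem exists_le_wordFiltration (U : Submodule k (NicholsAlgebra C.braiding))
    [FiniteDimensional k U] : ∃ d, U ≤ C.wordFiltration d := by
  obtain ⟨s, hs⟩ := (Submodule.fg_iff_finiteDimensional U).2 ‹_›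
  choose d hd using exists_mem_wordFiltration (C := C)
  refine ⟨s.sup d, ?_⟩
  rw [← hs, Submodule.span_le]
  exact fun a ha => wordFiltration_mono (Finset.le_sup ha) (hd a)

/-- The multiset with given multiplicities. -/
def multisetOfCount {D : ℕ} [Fintype X] (g : X → Fin D) : Multiset X :=
  ∑ a, (g a : ℕ) • ({a} : Multiset X)

theorem count_multisetOfCount [DecidableEq X] {D : ℕ} [Fintype X] (g : X → Fin D) (a : X) :
    (multisetOfCount g).count a = g a := by
  simp [multisetOfCount, Multiset.count_sum', Multiset.count_singleton]

theorem multisetOfCount_injective (D : ℕ) [Fintype X] :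
    Function.Injective (multisetOfCount : (X → Fin D) → Multiset X) := by
  classical
  intro g g' h
  ext a
  rw [← count_multisetOfCount, h, count_multisetOfCount]

theorem exists_multisetOfCount {D : ℕ} [Fintype X] {μ : Multiset X} (hμ : μ.card ≤ D) :
    ∃ g : X → Fin (D + 1), multisetOfCount g = μ := by
  classical
  refine ⟨fun a => ⟨μ.count a, Nat.lt_succ_of_le ((Multiset.count_le_card _ _).trans hμ)⟩, ?_⟩
  ext a
  rw [count_multisetOfCount]

theorem card_multisetOfCount_le {D : ℕ} [Fintype X] (g : X → Fin (D + 1)) :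
    (multisetOfCount g).card ≤ Fintype.card X * D := by
  rw [multisetOfCount, Multiset.card_sum, ← smul_eq_mul, Fintype.card, ← Finset.sum_const]
  refine Finset.sum_le_sum fun a _ => ?_
  have := (g a).2
  simp
  omega

/-- A word of length at most `D` has multiplicities at most `D` in its guitar image, so (D + 1)^m
elements suffice. -/
theorem exists_wordFiltration_le [Fintype X] (hK : C.IsGauge hS hinv K)
    (hR : ∀ i j, i ≠ S.diag hS j → C.R i j * C.R (S.σ i j) (S.τ j i) = 1) (D : ℕ) :
    ∃ h : (X → Fin (D + 1)) → NicholsAlgebra C.braiding,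
      C.wordFiltration D ≤ Submodule.span k (Set.range h) := by
  obtain ⟨h, hh⟩ := (quadraticRelations_generator hR hinv).exists_prod_eq hK
  refine ⟨fun g => h (multisetOfCount g), Submodule.span_le.2 ?_⟩
  rintro _ ⟨x, hx, rfl⟩
  obtain ⟨g, hg⟩ := exists_multisetOfCount (D := D) (μ := (guitar hS hinv 0 x : Multiset X))
    (by simpa using hx)
  rw [hh, ← hg]
  exact Submodule.smul_mem _ _ (Submodule.subset_span ⟨g, rfl⟩)

/-! ### The action on multisets and linear independence -/

variable (hS hinv K) in
/-- The right action of the letters on the space with basis the multisets. -/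
noncomputable def letterAction (x : X) : Module.End k (Multiset X →₀ k) :=
  Finsupp.basisSingleOne.constr k fun μ =>
    K μ (S.frame hS hinv μ x) • Finsupp.single (S.frame hS hinv μ x ::ₘ μ) (1 : k)

theorem letterAction_single (x : X) (μ : Multiset X) :
    letterAction hS hinv K x (Finsupp.single μ 1) =
      K μ (S.frame hS hinv μ x) • Finsupp.single (S.frame hS hinv μ x ::ₘ μ) (1 : k) := by
  have := (Finsupp.basisSingleOne (R := k) (ι := Multiset X)).constr_basis k (fun μ =>
    K μ (S.frame hS hinv μ x) • Finsupp.single (S.frame hS hinv μ x ::ₘ μ) (1 : k)) μ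
  rwa [Finsupp.coe_basisSingleOne] at this

theorem quadraticRelations_letterAction (hK : C.IsGauge hS hinv K) :
    C.QuadraticRelations hS fun a => MulOpposite.op (letterAction hS hinv K a) := by
  intro a b hab
  rw [← MulOpposite.op_mul, ← MulOpposite.op_mul, ← MulOpposite.op_smul]
  congr 1
  refine Finsupp.basisSingleOne.ext fun μ => ?_
  rw [Finsupp.coe_basisSingleOne, LinearMap.smul_apply, Module.End.mul_apply, Module.End.mul_apply]
  simp only [letterAction_single, map_smul, smul_smul, frame_mul_σPerm_τ]
  rw [frame_cons, Equiv.Perm.mul_apply, σPerm_apply, Multiset.cons_swap, hK.2 μ a b hab]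
  congr 1
  ring

/-- The coordinates of a word in the space with basis the multisets define a linear map on the
Nichols algebra. -/
theorem exists_coordinates [Fintype X] [CharZero k] (hK : C.IsGauge hS hinv K) {q : k}
    (hq : ∀ i, C.R (S.diag hS i) i = q) (hroot : ∀ n : ℕ, 2 ≤ n → ¬ IsPrimitiveRoot q n) :
    ∃ E : NicholsAlgebra C.braiding →ₗ[k] (Multiset X →₀ k), ∀ x : List X,
      E (x.map C.generator).prod =
        wordWeight hS hinv K 0 x • Finsupp.single (guitar hS hinv 0 x : Multiset X) (1 : k) := by
  -- The opposite algebra appears because a word acts by its first letter first.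
  let F : TensorAlgebra k (X →₀ k) →ₐ[k] (Module.End k (Multiset X →₀ k))ᵐᵒᵖ :=
    TensorAlgebra.lift k (Finsupp.basisSingleOne.constr k fun a =>
      MulOpposite.op (letterAction hS hinv K a))
  have hF : ∀ a, F (TensorAlgebra.ι k (Finsupp.single a 1)) =
      MulOpposite.op (letterAction hS hinv K a) := fun a => by
    have := (Finsupp.basisSingleOne (R := k) (ι := X)).constr_basis k (fun a =>
      MulOpposite.op (letterAction hS hinv K a)) a
    rw [Finsupp.coe_basisSingleOne] at this
    rw [TensorAlgebra.lift_ι_apply, this]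
  have hrel : ∀ ⦃x y⦄, Nichols.Rel C.braiding x y → F x = F y := by
    rintro _ _ ⟨n, v, hv⟩
    rw [map_zero]
    refine QuadraticRelations.map_eq_zero (B := (Module.End k (Multiset X →₀ k))ᵐᵒᵖ) hK hq
      hroot F ?_ hv
    simp only [hF]
    exact quadraticRelations_letterAction hK
  let G := RingQuot.liftAlgHom k ⟨F, hrel⟩
  have hG : ∀ a, G (C.generator a) = MulOpposite.op (letterAction hS hinv K a) := fun a => by
    rw [generator, RingQuot.liftAlgHom_mkAlgHom_apply, hF]
  have hword : ∀ (x : List X) (μ : Multiset X),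
      (G (x.map C.generator).prod).unop (Finsupp.single μ 1) =
        wordWeight hS hinv K μ x • Finsupp.single (guitar hS hinv μ x + μ) (1 : k) := by
    intro x
    induction x with
    | nil => intro μ; simp [wordWeight, guitar]
    | cons a t ih =>
      intro μ
      rw [List.map_cons, List.prod_cons, map_mul, MulOpposite.unop_mul, Module.End.mul_apply, hG,
        MulOpposite.unop_op, letterAction_single, map_smul, ih, smul_smul, wordWeight, guitar,
        ← Multiset.cons_coe, Multiset.cons_add, Multiset.add_cons]
  -- Acting on the empty multiset reads off the multiset of a word.
  refine ⟨LinearMap.applyₗ (Finsupp.single 0 1) ∘ₗ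
    (MulOpposite.opLinearEquiv k).symm.toLinearMap ∘ₗ G.toLinearMap, fun x => ?_⟩
  refine (hword x 0).trans ?_
  rw [add_zero]

/-- Each exponent vector is realized by a word through the inverse guitar map; the coordinates are
nonzero multiples of distinct basis vectors. -/
theorem exists_linearIndependent [Fintype X] [CharZero k] (hK : C.IsGauge hS hinv K) {q : k}
    (hq : ∀ i, C.R (S.diag hS i) i = q) (hroot : ∀ n : ℕ, 2 ≤ n → ¬ IsPrimitiveRoot q n) (D : ℕ) :
    ∃ x : (X → Fin (D + 1)) → List X, (∀ g, (x g).length ≤ Fintype.card X * D) ∧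
      LinearIndependent k fun g => ((x g).map C.generator).prod := by
  obtain ⟨E, hE⟩ := exists_coordinates hK hq hroot
  let x : (X → Fin (D + 1)) → List X := fun g => unguitar hS hinv 0 (multisetOfCount g).toList
  refine ⟨x, fun g => ?_, LinearIndependent.of_comp E ?_⟩
  · simpa [x] using card_multisetOfCount_le g
  · have h1 : LinearIndependent k fun g : X → Fin (D + 1) =>
        Finsupp.single (multisetOfCount g) (1 : k) := by
      have := (Finsupp.basisSingleOne (R := k) (ι := Multiset X)).linearIndependent.comp _
        (multisetOfCount_injective (X := X) (D + 1))
      rwa [Finsupp.coe_basisSingleOne] at this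
    have h2 := h1.units_smul fun g => Units.mk0 _ (wordWeight_ne_zero hK 0 (x g))
    convert h2 using 1
    funext g
    rw [Function.comp_apply, hE]
    simp only [x, guitar_unguitar, Multiset.coe_toList]
    rfl

end BraidingCoeff

/-! ### The Gelfand-Kirillov dimension -/

open Filter in
theorem tendsto_logb_natCast_const (c : ℝ) :
    Tendsto (fun n : ℕ => Real.logb n c) atTop (nhds 0) :=
  (Real.tendsto_log_atTop.comp tendsto_natCast_atTop_atTop).const_div_atTop _

open Filter in
theorem limsup_logb_eq_of_tendsto {f : ℕ → ℝ} {m : ℕ} (h : Tendsto f atTop (nhds m)) :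
    limsup (fun n => (f n : EReal)) atTop = (m : EReal) := by
  have := (continuous_coe_real_ereal.tendsto (m : ℝ)).comp h
  exact this.limsup_eq

open Filter in
/-- The Gelfand-Kirillov dimension of an algebra of polynomial growth of degree `m`. -/
theorem GKdim_eq_of_growth {k A : Type*} [Field k] [Ring A] [Algebra k A] (m : ℕ)
    (hup : ∀ U : Submodule k A, FiniteDimensional k U → ∃ D : ℕ, ∀ n : ℕ,
      Module.finrank k (⨆ i ∈ Finset.range (n + 1), U ^ i : Submodule k A) ≤ (D * n + 1) ^ m)
    (hlow : ∃ U : Submodule k A, FiniteDimensional k U ∧ ∃ c : ℕ, 0 < c ∧ ∀ n : ℕ,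
      n ^ m ≤ c * Module.finrank k (⨆ i ∈ Finset.range (n + 1), U ^ i : Submodule k A)) :
    GKdim k A = m := by
  apply le_antisymm
  · refine iSup₂_le fun U hU => ?_
    obtain ⟨D, hD⟩ := hup U hU
    -- For n ≥ 1 one has Dn + 1 ≤ n(D + 1), and log_n of (n(D + 1))^m tends to m.
    have hlim : Tendsto (fun n : ℕ => (m : ℝ) * (1 + Real.logb n (D + 1))) atTop (nhds m) := by
      simpa using ((tendsto_logb_natCast_const (D + 1)).const_add 1).const_mul (m : ℝ)
    rw [← limsup_logb_eq_of_tendsto hlim]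
    refine limsup_le_limsup ?_
    filter_upwards [eventually_ge_atTop 2] with n hn
    rw [EReal.coe_le_coe_iff]
    have hn1 : (1 : ℝ) < n := by exact_mod_cast hn
    have hn0 : (n : ℝ) ≠ 0 := by positivity
    have e : (m : ℝ) * (1 + Real.logb n (D + 1)) = Real.logb n ((n * (D + 1)) ^ m) := by
      rw [Real.logb_pow, Real.logb_mul hn0 (by positivity), Real.logb_self_eq_one hn1]
    rw [e]
    have hle := hD n
    generalize Module.finrank k (⨆ i ∈ Finset.range (n + 1), U ^ i : Submodule k A) = d at hle
    -- Dimension 0 is separate: monotonicity of the logarithm fails there, and `Real.logb` has the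
    -- default value 0.
    rcases Nat.eq_zero_or_pos d with rfl | hd
    · rw [← e, Nat.cast_zero, Real.logb_zero]
      have : 0 ≤ Real.logb n (D + 1) := Real.logb_nonneg hn1 (by simp)
      positivity
    · refine Real.logb_le_logb_of_le hn1 (by exact_mod_cast hd) ?_
      calc (d : ℝ) ≤ ((D * n + 1 : ℕ) : ℝ) ^ m := by exact_mod_cast hle
        _ ≤ _ := by
          gcongr
          push_cast
          nlinarith
  · obtain ⟨U, hU, c, hc, h⟩ := hlow
    refine le_trans ?_ (le_iSup₂ U hU)
    have hlim : Tendsto (fun n : ℕ => (m : ℝ) - Real.logb n c) atTop (nhds m) := by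
      simpa using (tendsto_logb_natCast_const c).const_sub (m : ℝ)
    rw [← limsup_logb_eq_of_tendsto hlim]
    refine limsup_le_limsup ?_
    filter_upwards [eventually_ge_atTop 2] with n hn
    rw [EReal.coe_le_coe_iff]
    have hn1 : (1 : ℝ) < n := by exact_mod_cast hn
    have hn0 : (n : ℝ) ≠ 0 := by positivity
    have hc0 : (c : ℝ) ≠ 0 := by exact_mod_cast hc.ne'
    have e : (m : ℝ) - Real.logb n c = Real.logb n (n ^ m / c) := by
      rw [Real.logb_div (by positivity) hc0, Real.logb_pow, Real.logb_self_eq_one hn1, mul_one]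
    rw [e]
    refine Real.logb_le_logb_of_le hn1 (by positivity) ?_
    rw [div_le_iff₀' (by positivity)]
    exact_mod_cast h n

open BraidingCoeff in
theorem corollary3p20 {k : Type*} [Field k] [IsAlgClosed k] [CharZero k]
    {X : Type*} [Fintype X] (hX : 2 ≤ Fintype.card X)
    (S : YBESolution X) (hS : S.Nondegenerate) (hinv : S.Involutive)
    (C : BraidingCoeff S k) (q : k)
    (hq : ∀ i, C.R (S.diag hS i) i = q)
    (hroot : ∀ n : ℕ, 2 ≤ n → ¬ IsPrimitiveRoot q n)
    (hR : ∀ i j, i ≠ S.diag hS j → C.R i j * C.R (S.σ i j) (S.τ j i) = 1) :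
    GKdim k (NicholsAlgebra C.braiding) = (Fintype.card X : EReal) := by
  classical
  obtain ⟨K, hK⟩ : ∃ K, C.IsGauge hS hinv K := exists_gauge hS hinv hR
  have hfin : ∀ D, FiniteDimensional k (C.wordFiltration D) := fun D => by
    obtain ⟨h, hh⟩ := exists_wordFiltration_le hK hR D
    have := FiniteDimensional.span_of_finite k (Set.finite_range h)
    exact Submodule.finiteDimensional_of_le hh
  have hle : ∀ (U : Submodule k (NicholsAlgebra C.braiding)) (D n : ℕ), U ≤ C.wordFiltration D →
      (⨆ i ∈ Finset.range (n + 1), U ^ i) ≤ C.wordFiltration (D * n) := fun U D n hU =>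
    iSup₂_le fun i hi => (pow_le_wordFiltration hU i).trans
      (wordFiltration_mono (Nat.mul_le_mul_left D (by rw [Finset.mem_range] at hi; omega)))
  refine GKdim_eq_of_growth _ (fun U hU => ?_) ⟨C.wordFiltration 1, hfin 1, ?_⟩
  · obtain ⟨D, hD⟩ := exists_le_wordFiltration U
    refine ⟨D, fun n => ?_⟩
    obtain ⟨h, hh⟩ := exists_wordFiltration_le hK hR (D * n)
    have := FiniteDimensional.span_of_finite k (Set.finite_range h)
    calc _ ≤ Module.finrank k (Submodule.span k (Set.range h)) :=
          Submodule.finrank_mono ((hle U D n hD).trans hh)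
      _ ≤ Fintype.card (X → Fin (D * n + 1)) := finrank_range_le_card h
      _ = _ := by simp
  -- Multiplicities up to ⌊n/m⌋ keep word lengths at most n; since n ≤ m(⌊n/m⌋ + 1), this costs only
  -- the factor m^m.
  · refine ⟨Fintype.card X ^ Fintype.card X, by positivity, fun n => ?_⟩
    obtain ⟨x, hx, hli⟩ := exists_linearIndependent hK hq hroot (n / Fintype.card X)
    have hmem : Submodule.span k (Set.range fun g => ((x g).map C.generator).prod) ≤
        ⨆ i ∈ Finset.range (n + 1), C.wordFiltration 1 ^ i := by
      rw [Submodule.span_le]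
      rintro _ ⟨g, rfl⟩
      have hlen : (x g).length ≤ n := (hx g).trans (Nat.mul_div_le _ _)
      refine Submodule.mem_iSup_of_mem (x g).length (Submodule.mem_iSup_of_mem
        (Finset.mem_range.2 (Nat.lt_succ_of_le hlen)) ?_)
      change ((x g).map C.generator).prod ∈ _
      generalize x g = l
      induction l with
      | nil => exact Submodule.one_le.1 (pow_zero _).ge
      | cons a t ih =>
        rw [List.map_cons, List.prod_cons, List.length_cons, pow_succ']
        exact Submodule.mul_mem_mul (Submodule.subset_span ⟨[a], by simp, by simp⟩) ih
    -- Finiteness is needed for monotonicity, since `finrank` is 0 on infinite-dimensional spaces.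
    have hd : FiniteDimensional k
        (⨆ i ∈ Finset.range (n + 1), C.wordFiltration 1 ^ i :
          Submodule k (NicholsAlgebra C.braiding)) := by
      have := hfin (1 * n)
      exact Submodule.finiteDimensional_of_le (hle _ 1 n le_rfl)
    have h1 := Submodule.finrank_mono hmem
    rw [finrank_span_eq_card hli] at h1
    simp only [Fintype.card_pi, Fintype.card_fin, Finset.prod_const, Finset.card_univ] at h1
    calc n ^ Fintype.card X
        ≤ (Fintype.card X * (n / Fintype.card X + 1)) ^ Fintype.card X :=
          Nat.pow_le_pow_left (Nat.lt_mul_div_succ n (by omega)).le _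
      _ ≤ _ := by rw [mul_pow]; exact Nat.mul_le_mul_left _ h1
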